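/- **Crystals.** Fix a finite set $I$ and the Cartan datum of a symmetrizable Kac–Moody algebra: a symmetrizable generalized Cartan matrix, a weight lattice $P$ (free of finite rank), linearly independent simple roots $\alpha_i\in P$ and linearly independent simple coroots $\alpha_i^\vee\in P^\vee$ realizing the matrix (no minimality of the rank of $P$ is required). A *normal crystal* is a set $\Gamma$ with maps $\mathrm{wt}:\Gamma\to P$, $\varepsilon_i,\varphi_i:\Gamma\to\mathbb N$ and Kashiwara operators $e_i,f_i:\Gamma\to\Gamma\sqcup\{0\}$ ($i\in I$) such that $\varphi_i(x)-\varepsilon_i(x)=\langle\alpha_i^\vee,\mathrm{wt}(x)\rangle$, $\varepsilon_i(x)=\max\{n: e_i^n.x\ne0\}$, $\varphi_i(x)=\max\{n: f_i^n.x\neq 0\}$, $\mathrm{wt}(e_i.x)=\mathrm{wt}(x)+\alpha_i$ if $e_i.x\ne0$, $\mathrm{wt}(f_i.x)=\mathrm{wt}(x)-\alpha_i$ if $f_i.x\neq0$, and $e_i.x=y\iff f_i.y=x$ for $x,y\in\Gamma$. The connected component of $x$ is the set of all $k_1.k_2.\cdots.k_l.x\ne0$ with $k_j$ Kashiwara operators;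 $x$ is *of highest weight* if $e_i.x=0$ for all $i$. A *crystal* is a normal crystal each of whose components contains exactly one element of highest weight, this element has dominant weight, and every element of the component is obtained from it by applying operators $f_i$. A *morphism* of (normal) crystals is a map commuting with $\mathrm{wt},\varepsilon_i,\varphi_i,e_i,f_i$ (with $0\mapsto0$). A *subcrystal* is a subset stable under the Kashiwara operators (i.e. $k.x$ is $0$ or again in the subset) which is a normal crystal for the restricted structure. The free monoid $X_1^*$ on a crystal $X_1$ carries the tensor product structure: $\mathrm{wt}(uv)=\mathrm{wt}(u)+\mathrm{wt}(v)$, $\varepsilon_i(uv)=\varepsilon_i(u)+\max(0,\varepsilon_i(v)-\varphi_i(u))$, $\varphi_i(uv)=\varphi_i(v)+\max(0,\varphi_i(u)-\varepsilon_i(v))$; $e_i$ acts on the factor $u$ of $uv$ if $\varphi_i(u)\ge\varepsilon_i(v)$ and on $v$ otherwise, and $f_i$ acts on $u$ if $\varphi_i(u)>\varepsilon_i(v)$ and on $v$ otherwise; on the empty word $\mathrm{wt},\varepsilon_i,\varphi_i$ vanish and all operators give $0$. **Crystal 2-polygraphs.** A *crystal 2-polygraph* $X=(X_1,X_2)$ consists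 of crystals $X_1$ (generators) and $X_2$ (rules) and two crystal morphisms $s,t:X_2\to X_1^*$. A rewriting step is $u\alpha v: u\,s(\alpha)\,v\Rightarrow u\,t(\alpha)\,v$ with $\alpha\in X_2$, $u,v\in X_1^*$. $X$ is *convergent* if rewriting terminates and is confluent. The presented monoid $\overline X=X_1^*/(s(\alpha)=t(\alpha))$ inherits the structure maps of $X_1^*$. A Kashiwara operator $k$ acts on a step $u\alpha v$ by acting on that one of the components $u,\alpha,v$ on which it acts in $u\otimes s(\alpha)\otimes v$. Let $X_2^\top$ be the free $(2,1)$-monoid on $X$; its 2-cells are composites for $\star_1$ of steps and formal inverses of steps, modulo the exchange relations and cancellation of inverses. Kashiwara operators act on its 2-cells by $k.(f\star_1g)=(k.f)\star_1(k.g)$, with $k.f=0$ iff $k.s(f)=0$. They act on pairs $(f,g)$ of steps with the same source (local branchings) and on pairs $(f,g)$ of parallel 2-cells (2-spheres) by $k.(f,g)=(k.f,k.g)$; the values of $\mathrm{wt},\varepsilon_i,\varphi_i$ on steps, 2-cells, local branchings and 2-spheres are those of the source word. A local branching $(f,g)$ is *critical* if $f\neq g$, it is not a Peiffer branching (a pair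 $(f'v,ug')$ with $f'$ of source $u$ and $g'$ of source $v$, in either order), and it is minimal for the order generated by $(f,g)\sqsubseteq(ufv,ugv)$. $\mathrm{Crit}(X)$ denotes the set of critical branchings. A *crystal section* is a section $r:\overline X\to X_1^*$ of the projection with $r(1)=1$ which is a morphism of crystals; write $\widehat w$ for $r$ of the class of $w$. A *crystal normalization strategy* for $r$ is a family of 2-cells $\sigma_w:w\Rightarrow\widehat w$ of $X_2^\top$ ($w\in X_1^*$) with $\sigma_{\widehat w}=1_{\widehat w}$ and $\sigma_{k.w}=k.\sigma_w$ for every Kashiwara operator $k$ with $k.w\neq0$. The family of *generating confluences* obtained from $r$ and $\sigma$ is $$\Omega=\{\gamma_{b}\ :\ b\in\mathrm{Crit}(X)\},\qquad \gamma_{(f,g)}=(f\star_1\sigma_{t(f)},\ g\star_1\sigma_{t(g)}).$$ **Theorem (Squier's coherence theorem for crystal 2-polygraphs).** Let $X$ be a convergent crystal 2-polygraph, $r$ a crystal section and $\sigma$ a crystal normalization strategy for $r$. Then: 1. $\Omega$ is a crystal cellular extension of $X_2^\top$, i.e. a subcrystal of its 2-spheres; 2. $\mathrm{Crit}(X)$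 is a subcrystal of the local branchings of $X$; 3. $b\mapsto\gamma_b$ is a morphism of crystals from $\mathrm{Crit}(X)$ to the 2-spheres; 4. the source map restricts to a bijection from each connected component of $\Omega$ onto a connected component of $X_1^*$; 5. for every $b\in\mathrm{Crit}(X)$ there are a critical branching $b_0$ of highest weight and indices $i_1,\dots,i_l$ with $f_{i_1}.\cdots.f_{i_l}.b_0=b$ and $f_{i_1}.\cdots.f_{i_l}.\gamma_{b_0}=\gamma_b$; 6. whenever $b_0\in\mathrm{Crit}(X)$ is of highest weight and $k_1,\dots,k_l$ are Kashiwara operators with $k_1.\cdots.k_l.b_0=b\in\mathrm{Crit}(X)$, then $k_1.\cdots.k_l.\gamma_{b_0}=\gamma_b$; so the elements of $\Omega$ are determined by those of the critical branchings of highest weight; 7. if the normal crystal $X_1^*$ is a crystal in the above sense, then $\Omega$ is a crystal too, and every connected component of $\mathrm{Crit}(X)$ contains exactly one critical branching of highest weight. -/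

import Mathlib

/-! ### Cartan data and crystals -/

/-- The Cartan datum of a symmetrizable Kac-Moody algebra: a symmetrizable generalized Cartan
matrix `A`, a weight lattice `P` with dual lattice of coweights, and linearly independent simple
roots and simple coroots realizing `A`. -/
structure CartanDatum (I : Type*) where
  A : Matrix I I ℤ
  diag : ∀ i, A i i = 2
  offDiag : ∀ i j, i ≠ j → A i j ≤ 0
  zero_symm : ∀ i j, A i j = 0 → A j i = 0
  symmetrizable : ∃ d : I → ℤ, (∀ i, 0 < d i) ∧ ∀ i j, d i * A i j = d j * A j i
  P : Type
  [addCommGroup : AddCommGroup P]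
  [free : Module.Free ℤ P]
  [finite : Module.Finite ℤ P]
  root : I → P
  coroot : I → Module.Dual ℤ P
  root_indep : LinearIndependent ℤ root
  coroot_indep : LinearIndependent ℤ coroot
  pairing : ∀ i j, coroot i (root j) = A i j

attribute [instance] CartanDatum.addCommGroup

/-- Dominant weights. -/
def CartanDatum.IsDominant {I : Type*} (D : CartanDatum I) (l : D.P) : Prop :=
  ∀ i, 0 ≤ D.coroot i l

/-- The symbols `e_i`, `f_i` of the Kashiwara operators. -/
inductive Kash (I : Type*) where
  | e (i : I)
  | f (i : I)

/-- Structure maps of a crystal on a set `Γ`, without axioms. The value `0` of a Kashiwara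
operator is `none`. The maps `ε_i`, `φ_i` take values in `ℕ`, as the normality axiom forces. -/
class CrystalData {I : Type*} (D : CartanDatum I) (Γ : Type*) where
  wt : Γ → D.P
  eps : I → Γ → ℕ
  phi : I → Γ → ℕ
  op : Kash I → Γ → Option Γ

namespace Crystal

open CrystalData

variable {I : Type*} (D : CartanDatum I)

/-- `applyOps [k₁, …, kₗ] x = k₁.k₂.⋯.kₗ.x`, which is `0` as soon as a partial result is `0`. -/
def applyOps {Γ : Type*} [CrystalData D Γ] : List (Kash I) → Γ → Option Γ
  | [], x => some x
  | k :: L, x => (applyOps L x).bind (op (D := D) k)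

/-- Normal crystals: `φ_i - ε_i` is the pairing of the weight with the simple coroot, `ε_i` and
`φ_i` are the largest powers of `e_i` and `f_i` that do not vanish, the operators shift weights by
simple roots, and `e_i`, `f_i` are partial inverses of each other. -/
structure IsNormal (Γ : Type*) [CrystalData D Γ] : Prop where
  phi_sub_eps : ∀ (x : Γ) (i : I),
    (phi D i x : ℤ) - (eps D i x : ℤ) = D.coroot i (wt x)
  eps_max : ∀ (x : Γ) (i : I),
    IsGreatest {n : ℕ | applyOps D (List.replicate n (Kash.e i)) x ≠ none} (eps D i x)
  phi_max : ∀ (x : Γ) (i : I),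
    IsGreatest {n : ℕ | applyOps D (List.replicate n (Kash.f i)) x ≠ none} (phi D i x)
  wt_e : ∀ (x y : Γ) (i : I), op (D := D) (Kash.e i) x = some y → wt y = wt (D := D) x + D.root i
  wt_f : ∀ (x y : Γ) (i : I), op (D := D) (Kash.f i) x = some y → wt y = wt (D := D) x - D.root i
  e_iff_f : ∀ (x y : Γ) (i : I),
    op (D := D) (Kash.e i) x = some y ↔ op (D := D) (Kash.f i) y = some x

/-- `y` lies in the connected component of `x`. -/
def Connected {Γ : Type*} [CrystalData D Γ] (x y : Γ) : Prop :=
  ∃ L : List (Kash I), applyOps D L x = some y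

/-- `x` is of highest weight: `e_i.x = 0` for all `i`. -/
def IsHighestWeight {Γ : Type*} [CrystalData D Γ] (x : Γ) : Prop :=
  ∀ i, op (D := D) (Kash.e i) x = none

/-- `y` is obtained from `x` by applying operators `f_i`. -/
def LowersTo {Γ : Type*} [CrystalData D Γ] (x y : Γ) : Prop :=
  ∃ L : List I, applyOps D (L.map Kash.f) x = some y

/-- Crystals: normal crystals each of whose connected components is a highest weight crystal, that
is, has a unique element of highest weight, of dominant weight, from which every element of the
component is obtained by applying operators `f_i`. -/
structure IsCrystal (Γ : Type*) [CrystalData D Γ] : Prop extends IsNormal D Γ where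
  component : ∀ x : Γ, ∃ x₀ : Γ, Connected D x x₀ ∧ D.IsDominant (wt x₀) ∧
    (∀ y, Connected D x y → (IsHighestWeight D y ↔ y = x₀)) ∧
    ∀ y, Connected D x y → LowersTo D x₀ y

/-- (Strict) morphisms of crystals: maps commuting with all the structure maps, including `0`. -/
structure IsHom {Γ Δ : Type*} [CrystalData D Γ] [CrystalData D Δ] (F : Γ → Δ) : Prop where
  wt_eq : ∀ x, wt (D := D) (F x) = wt x
  eps_eq : ∀ i x, eps D i (F x) = eps D i x
  phi_eq : ∀ i x, phi D i (F x) = phi D i x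
  op_eq : ∀ k x, op (D := D) k (F x) = (op (D := D) k x).map F

open Classical in
/-- The restricted structure maps on a subset `S`; an operator leading out of `S` becomes `0`. -/
noncomputable instance restrict {Γ : Type*} [CrystalData D Γ] (S : Set Γ) : CrystalData D S where
  wt x := wt x.1
  eps i x := eps D i x.1
  phi i x := phi D i x.1
  op k x := (op (D := D) k x.1).bind fun y => if h : y ∈ S then some ⟨y, h⟩ else none

/-- Subcrystals: subsets which satisfy the axioms of normal crystals for the restricted structure
maps and whose inclusion is a morphism of crystals. The latter says that they are stable under the
Kashiwara operators, i.e. that they are unions of connected components. -/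
structure IsSubcrystal {Γ : Type*} [CrystalData D Γ] (S : Set Γ) : Prop where
  isNormal : IsNormal D S
  isHom : IsHom D (Subtype.val : S → Γ)

/-! ### Tensor products and the free crystal monoid -/

/-- In a tensor product `u ⊗ v`, the operator `k` acts on the factor `u`, where `p i = φ_i(u)` and
`q i = ε_i(v)`; otherwise it acts on `v`. -/
def ActsLeft : Kash I → (I → ℕ) → (I → ℕ) → Prop
  | Kash.e i, p, q => q i ≤ p i
  | Kash.f i, p, q => q i < p i

instance (k : Kash I) (p q : I → ℕ) : Decidable (ActsLeft k p q) :=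
  match k with
  | Kash.e i => inferInstanceAs (Decidable (q i ≤ p i))
  | Kash.f i => inferInstanceAs (Decidable (q i < p i))

section Word

variable {Γ : Type*} [CrystalData D Γ]

/-- `ε_i` on `Γ^*`, following `ε_i(u ⊗ v) = ε_i(u) + max(0, ε_i(v) - φ_i(u))`. -/
def wordEps (i : I) : List Γ → ℕ
  | [] => 0
  | x :: w => eps D i x + (wordEps i w - phi D i x)

/-- `φ_i` on `Γ^*`, following `φ_i(u ⊗ v) = φ_i(v) + max(0, φ_i(u) - ε_i(v))`. -/
def wordPhi (i : I) : List Γ → ℕ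
  | [] => 0
  | x :: w => wordPhi i w + (phi D i x - wordEps D i w)

/-- The Kashiwara operators on `Γ^*`: a word `x :: w` is the tensor product `x ⊗ w`. -/
def wordOp (k : Kash I) : List Γ → Option (List Γ)
  | [] => none
  | x :: w =>
    if ActsLeft k (fun i => phi D i x) (fun i => wordEps D i w) then
      (op (D := D) k x).map fun y => y :: w
    else (wordOp k w).map fun v => x :: v

/-- The free crystal monoid `Γ^*`, the disjoint union of the tensor powers of `Γ`. -/
instance word : CrystalData D (List Γ) where
  wt w := (w.map wt).sum
  eps := wordEps D
  phi := wordPhi D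
  op := wordOp D

theorem eps_append (i : I) (u v : List Γ) :
    eps D i (u ++ v) = eps D i u + (eps D i v - phi D i u) := by
  induction u with
  | nil => simp [eps, phi, wordEps, wordPhi]
  | cons x u ih =>
    simp only [eps, phi, List.cons_append, wordEps, wordPhi] at ih ⊢
    omega

theorem phi_append (i : I) (u v : List Γ) :
    phi D i (u ++ v) = phi D i v + (phi D i u - eps D i v) := by
  induction u with
  | nil => simp [eps, phi, wordPhi]
  | cons x u ih =>
    have h := eps_append D i u v
    simp only [eps, phi, List.cons_append, wordPhi] at ih h ⊢
    omega

theorem wt_append (u v : List Γ) : wt (D := D) (u ++ v) = wt u + wt v := by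
  simp [wt]

variable {D}

theorem IsNormal.e_eq_none {Γ : Type*} [CrystalData D Γ] (h : IsNormal D Γ) {x : Γ} {i : I}
    (hx : eps D i x = 0) : op (D := D) (Kash.e i) x = none := by
  by_contra hne
  have := (h.eps_max x i).2 (show 1 ∈ _ by simpa [applyOps] using hne)
  omega

theorem word_e_eq_none (h : IsNormal D Γ) {w : List Γ} {i : I} (hw : eps D i w = 0) :
    op (D := D) (Kash.e i) w = none := by
  induction w with
  | nil => rfl
  | cons x w ih =>
    replace hw : eps D i x + (eps D i w - phi D i x) = 0 := hw
    change (if ActsLeft _ (fun i => phi D i x) (fun i => eps D i w) then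
      (op (D := D) _ x).map _ else (op (D := D) _ w).map _) = none
    have hc : ActsLeft (Kash.e i) (fun i => phi D i x) (fun i => eps D i w) := by
      change eps D i w ≤ phi D i x
      omega
    rw [if_pos hc, h.e_eq_none (by omega)]
    rfl

theorem op_append (h : IsNormal D Γ) (k : Kash I) (u v : List Γ) :
    op (D := D) k (u ++ v) =
      if ActsLeft k (fun i => phi D i u) (fun i => eps D i v) then
        (op (D := D) k u).map fun u' => u' ++ v
      else (op (D := D) k v).map fun v' => u ++ v' := by
  induction u with
  | nil =>
    rcases k with i | i
    · split_ifs with hc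
      · simp only [ActsLeft, phi, wordPhi] at hc
        rw [List.nil_append, word_e_eq_none h (by omega)]
        rfl
      · simp
    · rw [if_neg (by simp [ActsLeft, phi, wordPhi])]
      simp
  | cons x u ih =>
    have h1 := fun i => eps_append D i u v
    have h2 : op (D := D) k (x :: u ++ v) =
      if ActsLeft k (fun i => phi D i x) (fun i => eps D i (u ++ v)) then
        (op (D := D) k x).map fun y => y :: (u ++ v)
      else (op (D := D) k (u ++ v)).map fun v => x :: v := rfl
    have h3 : op (D := D) k (x :: u) =
      if ActsLeft k (fun i => phi D i x) (fun i => eps D i u) then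
        (op (D := D) k x).map fun y => y :: u
      else (op (D := D) k u).map fun v => x :: v := rfl
    have h4 : ∀ i, phi D i (x :: u) = phi D i u + (phi D i x - eps D i u) := fun _ => rfl
    rw [h2, ih, h3]
    rcases k with i | i <;> split_ifs <;> simp only [ActsLeft, h1, h4] at * <;>
      first
      | (exfalso; omega)
      | simp [Function.comp_def]

end Word

/-! ### 2-polygraphs and rewriting -/

/-- A 2-polygraph with generating 1-cells `A` and generating 2-cells `R`. -/
structure Polygraph (A R : Type*) where
  src : R → List A
  tgt : R → List A

namespace Polygraph

variable {A R : Type*} (X : Polygraph A R)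

/-- Rewriting steps `t α v`, with `t, v` words and `α` a generating 2-cell. -/
@[ext]
structure Step {A R : Type*} (X : Polygraph A R) where
  left : List A
  rule : R
  right : List A

namespace Step

variable {X}

def source (s : X.Step) : List A := s.left ++ X.src s.rule ++ s.right

def target (s : X.Step) : List A := s.left ++ X.tgt s.rule ++ s.right

/-- The step `u s v`. -/
def whisker (u : List A) (s : X.Step) (v : List A) : X.Step :=
  ⟨u ++ s.left, s.rule, s.right ++ v⟩

end Step

/-- `w ⟹ w'` in the abstract rewriting system of `X`. -/
def Rewrites (w w' : List A) : Prop := ∃ s : X.Step, s.source = w ∧ s.target = w'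

/-- There is no infinite rewriting sequence. -/
def IsTerminating : Prop := ¬ ∃ w : ℕ → List A, ∀ n, X.Rewrites (w n) (w (n + 1))

/-- All branchings are confluent. -/
def IsConfluent : Prop :=
  ∀ w w₁ w₂, Relation.ReflTransGen X.Rewrites w w₁ → Relation.ReflTransGen X.Rewrites w w₂ →
    ∃ w₃, Relation.ReflTransGen X.Rewrites w₁ w₃ ∧ Relation.ReflTransGen X.Rewrites w₂ w₃

def IsConvergent : Prop := X.IsTerminating ∧ X.IsConfluent

/-- Local branchings: pairs of rewriting steps with the same source. -/
@[ext]
structure LocalBranching where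
  fst : X.Step
  snd : X.Step
  source_eq : fst.source = snd.source

namespace LocalBranching

variable {X}

def source (b : X.LocalBranching) : List A := b.fst.source

/-- `b ⊑ c`: one has `c = (u f v, u g v)` where `b = (f, g)`. -/
def Le (b c : X.LocalBranching) : Prop :=
  ∃ u v, c.fst = b.fst.whisker u v ∧ c.snd = b.snd.whisker u v

def IsAspherical (b : X.LocalBranching) : Prop := b.fst = b.snd

/-- Peiffer branchings: `(f v, u g)` with `f` of source `u` and `g` of source `v`, in either
order. -/
def IsPeiffer (b : X.LocalBranching) : Prop :=
  ∃ f g : X.Step,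
    (b.fst = f.whisker [] g.source ∧ b.snd = g.whisker f.source []) ∨
    (b.snd = f.whisker [] g.source ∧ b.fst = g.whisker f.source [])

/-- Critical branchings: overlapping local branchings which are minimal for `⊑`. -/
def IsCritical (b : X.LocalBranching) : Prop :=
  ¬ b.IsAspherical ∧ ¬ b.IsPeiffer ∧ ∀ c : X.LocalBranching, c.Le b → b.Le c

end LocalBranching

/-- The set of critical branchings. -/
def Crit : Set X.LocalBranching := {b | b.IsCritical}

/-- The defining relations `s(α) ~ t(α)` of the presented monoid. -/
def relation (u v : FreeMonoid A) : Prop :=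
  ∃ α, u = FreeMonoid.ofList (X.src α) ∧ v = FreeMonoid.ofList (X.tgt α)

/-- The monoid presented by `X`. -/
abbrev Mon : Type _ := PresentedMonoid X.relation

/-- The class of a word in the presented monoid. -/
def toMon (w : List A) : X.Mon := PresentedMonoid.mk X.relation (FreeMonoid.ofList w)

theorem toMon_append (u v : List A) : X.toMon (u ++ v) = X.toMon u * X.toMon v := rfl

theorem toMon_src (α : R) : X.toMon (X.src α) = X.toMon (X.tgt α) :=
  (Con.eq _).2 (ConGen.Rel.of _ _ ⟨α, rfl, rfl⟩)

theorem toMon_source (s : X.Step) : X.toMon s.source = X.toMon s.target := by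
  simp only [Step.source, Step.target, toMon_append, toMon_src]

/-! ### The free (2,1)-monoid -/

/-- The 2-polygraph `X^±`, obtained from `X` by adding a formal inverse of each generating
2-cell. -/
def pm : Polygraph A (R ⊕ R) where
  src := Sum.elim X.src X.tgt
  tgt := Sum.elim X.tgt X.src

/-- `L` is a list of composable steps starting at the word `w`. -/
def IsPath {X : Polygraph A R} : List A → List X.Step → Prop
  | _, [] => True
  | w, s :: L => s.source = w ∧ IsPath s.target L

/-- The target of a list of composable steps starting at `w`. -/
def pathEnd {X : Polygraph A R} : List A → List X.Step → List A
  | w, [] => w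
  | _, s :: L => pathEnd s.target L

theorem isPath_append {X : Polygraph A R} (w : List A) (L M : List X.Step) :
    IsPath w (L ++ M) ↔ IsPath w L ∧ IsPath (pathEnd w L) M := by
  induction L generalizing w with
  | nil => simp [IsPath, pathEnd]
  | cons s L ih => simp [IsPath, pathEnd, ih, and_assoc]

theorem pathEnd_append {X : Polygraph A R} (w : List A) (L M : List X.Step) :
    pathEnd w (L ++ M) = pathEnd (pathEnd w L) M := by
  induction L generalizing w with
  | nil => rfl
  | cons s L ih => exact ih _

/-- Composites `(u₁ α₁ v₁) ⋆₁ ⋯ ⋆₁ (uₙ αₙ vₙ)` of steps of `X^±`. -/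
@[ext]
structure ZigZag where
  start : List A
  steps : List X.pm.Step
  isPath : IsPath start steps

/-- The defining relations of the 2-cells: the exchange relation
`α w v ⋆₁ u' w β ≡ u w β ⋆₁ α w v'` for `α : u ⟹ u'` and `β : v ⟹ v'`, and the cancellation
of `α` with its inverse, all of them whiskered by arbitrary words `l` and `r`. -/
inductive CellRule : List X.pm.Step → List X.pm.Step → Prop
  | exchange (l w r : List A) (α β : R ⊕ R) :
      CellRule
        [⟨l, α, w ++ X.pm.src β ++ r⟩, ⟨l ++ X.pm.tgt α ++ w, β, r⟩]
        [⟨l ++ X.pm.src α ++ w, β, r⟩, ⟨l, α, w ++ X.pm.tgt β ++ r⟩]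
  | cancel (l r : List A) (α : R ⊕ R) :
      CellRule [⟨l, α, r⟩, ⟨l, α.swap, r⟩] []

namespace ZigZag

variable {X}

def finish (p : X.ZigZag) : List A := pathEnd p.start p.steps

/-- One application of a defining relation inside a composite. -/
def Rel (p q : X.ZigZag) : Prop :=
  p.start = q.start ∧ ∃ a b x y, X.CellRule x y ∧ p.steps = a ++ x ++ b ∧ q.steps = a ++ y ++ b

theorem pathEnd_rule {x y : List X.pm.Step} (h : X.CellRule x y) {w : List A} (hw : IsPath w x) :
    pathEnd w x = pathEnd w y := by
  cases h with
  | exchange l v r α β => simp [pathEnd, Step.target]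
  | cancel l r α =>
    obtain ⟨h1, -⟩ := hw
    rw [← h1]
    cases α <;> simp [pathEnd, Step.target, Step.source, pm]

theorem Rel.finish_eq {p q : X.ZigZag} (h : Rel p q) : p.finish = q.finish := by
  obtain ⟨h0, a, b, x, y, hr, hp, hq⟩ := h
  have hpath := p.isPath
  rw [hp, isPath_append, isPath_append] at hpath
  rw [finish, finish, hp, hq, ← h0]
  simp only [pathEnd_append]
  rw [pathEnd_rule hr hpath.1.2]

open Classical in
/-- The composite `p ⋆₁ q`; by convention it is `p` if `p` and `q` are not composable. -/
noncomputable def comp (p q : X.ZigZag) : X.ZigZag :=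
  if h : p.finish = q.start then
    ⟨p.start, p.steps ++ q.steps, (isPath_append _ _ _).2 ⟨p.isPath, by
      have := q.isPath
      rw [← h] at this
      exact this⟩⟩
  else p

end ZigZag

/-- The 2-cells of the free (2,1)-monoid `X_2^⊤`. The relation `ZigZag.Rel` is stable under
whiskering and under `⋆₁`, so the equivalence relation that it generates is a congruence. -/
def Cell : Type _ := Quot (ZigZag.Rel (X := X))

namespace Cell

variable {X}

def src (c : X.Cell) : List A := Quot.lift ZigZag.start (fun _ _ h => h.1) c

def tgt (c : X.Cell) : List A := Quot.lift ZigZag.finish (fun _ _ h => h.finish_eq) c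

/-- The identity 2-cell of a word. -/
def id (w : List A) : X.Cell := Quot.mk _ ⟨w, [], trivial⟩

/-- The 2-cell of a rewriting step of `X`. -/
def ofStep (s : X.Step) : X.Cell :=
  Quot.mk _ ⟨s.source, [⟨s.left, Sum.inl s.rule, s.right⟩], rfl, trivial⟩

/-- The composition `⋆₁` of 2-cells; by convention `c ⋆₁ d = c` if `tgt c ≠ src d`. -/
noncomputable def comp : X.Cell → X.Cell → X.Cell :=
  Quot.lift₂ (fun p q => Quot.mk _ (p.comp q))
    (by
      rintro p q q' ⟨h0, a, b, x, y, hr, hq, hq'⟩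
      by_cases h : p.finish = q.start
      · have h' : p.finish = q'.start := h.trans h0
        simp only [ZigZag.comp, dif_pos h, dif_pos h']
        exact Quot.sound ⟨rfl, p.steps ++ a, b, x, y, hr, by simp [hq], by simp [hq']⟩
      · have h' : ¬ p.finish = q'.start := fun e => h (e.trans h0.symm)
        simp only [ZigZag.comp, dif_neg h, dif_neg h']
        rfl)
    (by
      rintro p p' q hp
      have hf := hp.finish_eq
      by_cases h : p.finish = q.start
      · have h' : p'.finish = q.start := hf.symm.trans h
        obtain ⟨h0, a, b, x, y, hr, hq, hq'⟩ := hp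
        simp only [ZigZag.comp, dif_pos h, dif_pos h']
        exact Quot.sound ⟨h0, a, b ++ q.steps, x, y, hr, by simp [hq], by simp [hq']⟩
      · have h' : ¬ p'.finish = q.start := fun e => h (hf.trans e)
        simp only [ZigZag.comp, dif_neg h, dif_neg h']
        exact Quot.sound hp)

end Cell

end Polygraph

/-! ### Crystal 2-polygraphs -/

section Equivariant

variable {D} {A R : Type*} [CrystalData D A] [CrystalData D R]

/-- The disjoint union of two crystals. -/
instance sum {Γ Δ : Type*} [CrystalData D Γ] [CrystalData D Δ] : CrystalData D (Γ ⊕ Δ) where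
  wt := Sum.elim wt wt
  eps i := Sum.elim (eps D i) (eps D i)
  phi i := Sum.elim (phi D i) (phi D i)
  op k := Sum.elim (fun x => (op (D := D) k x).map Sum.inl) fun y => (op (D := D) k y).map Sum.inr

/-- The structure maps on the set of rewriting steps: `k` acts on the component of `t α v` on
which it acts in the source `t ⊗ s(α) ⊗ v`. -/
instance step (X : Polygraph A R) : CrystalData D X.Step where
  wt s := wt s.source
  eps i s := eps D i s.source
  phi i s := phi D i s.source
  op k s :=
    if ActsLeft k (fun i => phi D i s.left) (fun i => eps D i (X.src s.rule ++ s.right)) then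
      (op (D := D) k s.left).map fun t => ⟨t, s.rule, s.right⟩
    else if ActsLeft k (fun i => phi D i (X.src s.rule)) (fun i => eps D i s.right) then
      (op (D := D) k s.rule).map fun α => ⟨s.left, α, s.right⟩
    else (op (D := D) k s.right).map fun v => ⟨s.left, s.rule, v⟩

namespace Polygraph

variable (D) in
/-- The source and target maps are morphisms of crystals. -/
structure IsEquivariant (X : Polygraph A R) : Prop where
  gen : IsNormal D A
  src : IsHom D X.src
  tgt : IsHom D X.tgt

variable {X : Polygraph A R}

theorem IsEquivariant.pm (h : X.IsEquivariant D) : X.pm.IsEquivariant D := by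
  have h1 := h.src
  have h2 := h.tgt
  refine ⟨h.gen, ⟨?_, ?_, ?_, ?_⟩, ⟨?_, ?_, ?_, ?_⟩⟩
  · rintro (x | x)
    exacts [h1.wt_eq x, h2.wt_eq x]
  · rintro i (x | x)
    exacts [h1.eps_eq i x, h2.eps_eq i x]
  · rintro i (x | x)
    exacts [h1.phi_eq i x, h2.phi_eq i x]
  · rintro k (x | x)
    · exact (h1.op_eq k x).trans (by simp [Polygraph.pm, op, Function.comp_def])
    · exact (h2.op_eq k x).trans (by simp [Polygraph.pm, op, Function.comp_def])
  · rintro (x | x)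
    exacts [h2.wt_eq x, h1.wt_eq x]
  · rintro i (x | x)
    exacts [h2.eps_eq i x, h1.eps_eq i x]
  · rintro i (x | x)
    exacts [h2.phi_eq i x, h1.phi_eq i x]
  · rintro k (x | x)
    · exact (h2.op_eq k x).trans (by simp [Polygraph.pm, op, Function.comp_def])
    · exact (h1.op_eq k x).trans (by simp [Polygraph.pm, op, Function.comp_def])

theorem op_source (h : X.IsEquivariant D) (k : Kash I) (s : X.Step) :
    op (D := D) k s.source = (op (D := D) k s).map Step.source := by
  obtain ⟨t, α, v⟩ := s
  simp only [Step.source, List.append_assoc]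
  rw [op_append h.gen, op_append h.gen, h.src.op_eq]
  simp only [op]
  split_ifs <;> simp [Function.comp_def, Step.source]

theorem op_target (h : X.IsEquivariant D) (k : Kash I) (s : X.Step) :
    op (D := D) k s.target = (op (D := D) k s).map Step.target := by
  obtain ⟨t, α, v⟩ := s
  simp only [Step.target, List.append_assoc]
  rw [op_append h.gen, op_append h.gen, h.tgt.op_eq]
  simp only [eps_append, h.tgt.eps_eq, h.tgt.phi_eq, ← h.src.eps_eq, ← h.src.phi_eq]
  simp only [← eps_append, op]
  split_ifs <;> simp [Function.comp_def, Step.target]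

theorem op_step (k : Kash I) (t : List A) (α : R) (v : List A) :
    op (D := D) k (⟨t, α, v⟩ : X.Step) =
    if ActsLeft k (fun i => phi D i t) (fun i => eps D i (X.src α ++ v)) then
      (op (D := D) k t).map fun t => ⟨t, α, v⟩
    else if ActsLeft k (fun i => phi D i (X.src α)) (fun i => eps D i v) then
      (op (D := D) k α).map fun α => ⟨t, α, v⟩
    else (op (D := D) k v).map fun v => ⟨t, α, v⟩ := rfl

theorem isPath_op (h : X.IsEquivariant D) {k : Kash I} {w w' : List A} (hw : op (D := D) k w = some w')
    {L : List X.Step} (hL : IsPath w L) :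
    IsPath w' (L.filterMap (op (D := D) k)) ∧
      op (D := D) k (pathEnd w L) = some (pathEnd w' (L.filterMap (op (D := D) k))) := by
  induction L generalizing w w' with
  | nil => exact ⟨trivial, hw⟩
  | cons s L ih =>
    obtain ⟨hs, hL⟩ := hL
    have h1 := op_source h k s
    have h2 := op_target h k s
    rw [hs, hw] at h1
    obtain ⟨s', hs', rfl⟩ := Option.map_eq_some_iff.1 h1.symm
    rw [hs'] at h2
    obtain ⟨h3, h4⟩ := ih h2 hL
    rw [List.filterMap_cons_some hs']
    exact ⟨⟨rfl, h3⟩, h4⟩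

theorem CellRule.op (h : X.IsEquivariant D) {k : Kash I} {x y : List X.pm.Step} (hr : X.CellRule x y) {w w' : List A}
    (hw : op (D := D) k w = some w') (hx : IsPath w x) :
    X.CellRule (x.filterMap (op (D := D) k)) (y.filterMap (op (D := D) k)) := by
  have hE := h.pm
  cases hr with
  | exchange l v r α β =>
    obtain ⟨h1, -⟩ := hx
    subst h1
    have hsα := hE.src.op_eq k α
    have htα := hE.tgt.op_eq k α
    have hsβ := hE.src.op_eq k β
    have htβ := hE.tgt.op_eq k β
    have e1 : ∀ i, eps D i (X.pm.tgt α) = eps D i (X.pm.src α) := fun i =>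
      (hE.tgt.eps_eq i α).trans (hE.src.eps_eq i α).symm
    have p1 : ∀ i, phi D i (X.pm.tgt α) = phi D i (X.pm.src α) := fun i =>
      (hE.tgt.phi_eq i α).trans (hE.src.phi_eq i α).symm
    have e2 : ∀ i, eps D i (X.pm.tgt β) = eps D i (X.pm.src β) := fun i =>
      (hE.tgt.eps_eq i β).trans (hE.src.eps_eq i β).symm
    have p2 : ∀ i, phi D i (X.pm.tgt β) = phi D i (X.pm.src β) := fun i =>
      (hE.tgt.phi_eq i β).trans (hE.src.phi_eq i β).symm
    simp only [Step.source, List.append_assoc] at hw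
    simp only [op_append h.gen, eps_append] at hw
    simp only [List.filterMap_cons, List.filterMap_nil, op_step, List.append_assoc,
      op_append h.gen, eps_append, phi_append, e1, p1, e2, p2]
    rcases k with i | i
    all_goals
      split_ifs at hw ⊢ <;> simp only [ActsLeft] at * <;> first
        | (exfalso; omega)
        | skip
    all_goals
      simp only [Option.map_eq_some_iff, Option.map_map] at hw
      obtain ⟨a, ha, -⟩ := hw
      first
      | (simp only [ha, Option.map_some]
         first
         | simpa using CellRule.exchange a v r α β
         | simpa using CellRule.exchange l a r α β
         | simpa using CellRule.exchange l v a α β)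
      | (rw [hsα] at ha
         obtain ⟨α', hα', -⟩ := Option.map_eq_some_iff.1 ha
         simp only [hsα, htα, hα', Option.map_some]
         simpa using CellRule.exchange l v r α' β)
      | (rw [hsβ] at ha
         obtain ⟨β', hβ', -⟩ := Option.map_eq_some_iff.1 ha
         simp only [hsβ, htβ, hβ', Option.map_some]
         simpa using CellRule.exchange l v r α β')
  | cancel l r α =>
    obtain ⟨h1, -⟩ := hx
    subst h1
    have hs := hE.src.op_eq k α
    have e1 : ∀ i, eps D i (X.pm.src α.swap) = eps D i (X.pm.src α) := fun i => by
      rcases α with α | α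
      exacts [(h.tgt.eps_eq i α).trans (h.src.eps_eq i α).symm,
        (h.src.eps_eq i α).trans (h.tgt.eps_eq i α).symm]
    have p1 : ∀ i, phi D i (X.pm.src α.swap) = phi D i (X.pm.src α) := fun i => by
      rcases α with α | α
      exacts [(h.tgt.phi_eq i α).trans (h.src.phi_eq i α).symm,
        (h.src.phi_eq i α).trans (h.tgt.phi_eq i α).symm]
    have o1 : CrystalData.op (D := D) k α.swap = (CrystalData.op (D := D) k α).map Sum.swap := by
      rcases α with α | α <;> simp [CrystalData.op, Function.comp_def]
    simp only [Step.source, List.append_assoc] at hw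
    simp only [op_append h.gen, eps_append] at hw
    simp only [List.filterMap_cons, List.filterMap_nil, op_step, eps_append, e1, p1]
    split_ifs at hw ⊢
    all_goals
      simp only [Option.map_eq_some_iff, Option.map_map] at hw
      obtain ⟨a, ha, -⟩ := hw
      first
      | (simp only [ha, Option.map_some]
         first
         | exact CellRule.cancel a r α
         | exact CellRule.cancel l a α)
      | (rw [hs] at ha
         obtain ⟨α', hα', -⟩ := Option.map_eq_some_iff.1 ha
         simp only [o1, hα', Option.map_some]
         exact CellRule.cancel l r α')

/-- The Kashiwara operators on composites of steps of `X^±`: by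
`k.(p ⋆₁ q) = (k.p) ⋆₁ (k.q)` they act step by step if `k.s(p) ≠ 0`, in which case `k` is nonzero
on every step, and `k.p = 0` if `k.s(p) = 0`. -/
def ZigZag.act (h : X.IsEquivariant D) (k : Kash I) (p : X.ZigZag) : Option X.ZigZag :=
  match hw : op (D := D) k p.start with
  | none => none
  | some w => some ⟨w, p.steps.filterMap (op (D := D) k), (isPath_op h.pm hw p.isPath).1⟩

theorem ZigZag.act_eq_some_iff (h : X.IsEquivariant D) {k : Kash I} {p q : X.ZigZag} :
    p.act h k = some q ↔
      op (D := D) k p.start = some q.start ∧ q.steps = p.steps.filterMap (op (D := D) k) := by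
  unfold ZigZag.act
  split
  next hw => simp [hw]
  next w hw =>
    simp only [Option.some.injEq, ZigZag.ext_iff, hw]
    tauto

theorem ZigZag.act_eq_none_iff (h : X.IsEquivariant D) {k : Kash I} {p : X.ZigZag} :
    p.act h k = none ↔ op (D := D) k p.start = none := by
  unfold ZigZag.act
  split <;> simp [*]

theorem ZigZag.act_finish (h : X.IsEquivariant D) {k : Kash I} {p q : X.ZigZag} (hq : p.act h k = some q) :
    op (D := D) k p.finish = some q.finish := by
  obtain ⟨h1, h2⟩ := (act_eq_some_iff h).1 hq
  rw [finish, finish, h2]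
  exact (isPath_op h.pm h1 p.isPath).2

theorem ZigZag.Rel.act (h : X.IsEquivariant D) {k : Kash I} {p q : X.ZigZag} (hpq : ZigZag.Rel p q) :
    (p.act h k).map (Quot.mk ZigZag.Rel) = (q.act h k).map (Quot.mk ZigZag.Rel) := by
  obtain ⟨h0, a, b, x, y, hr, hp, hq⟩ := hpq
  rcases hw : op (D := D) k p.start with - | w
  · rw [(act_eq_none_iff h).2 hw, (act_eq_none_iff h).2 (h0 ▸ hw)]
  · have hP := p.isPath
    rw [hp, isPath_append, isPath_append] at hP
    have hend := (isPath_op h.pm hw hP.1.1).2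
    have hr' := CellRule.op h hr hend hP.1.2
    have hw' : op (D := D) k q.start = some w := h0 ▸ hw
    obtain ⟨p', hp'⟩ : ∃ p', p.act h k = some p' := Option.ne_none_iff_exists'.1 fun e => by
      simp [(act_eq_none_iff h).1 e] at hw
    obtain ⟨q', hq'⟩ : ∃ q', q.act h k = some q' := Option.ne_none_iff_exists'.1 fun e => by
      simp [(act_eq_none_iff h).1 e] at hw'
    rw [hp', hq']
    obtain ⟨h1, h2⟩ := (act_eq_some_iff h).1 hp'
    obtain ⟨h3, h4⟩ := (act_eq_some_iff h).1 hq'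
    refine congrArg some (Quot.sound ⟨?_, a.filterMap (CrystalData.op (D := D) k),
      b.filterMap (CrystalData.op (D := D) k), _, _, hr', ?_, ?_⟩)
    · rw [hw] at h1
      rw [hw'] at h3
      exact Option.some_injective _ (h1.symm.trans h3)
    · rw [h2, hp, List.filterMap_append, List.filterMap_append]
    · rw [h4, hq, List.filterMap_append, List.filterMap_append]

/-- The Kashiwara operators on the 2-cells of `X_2^⊤`. -/
def Cell.act (h : X.IsEquivariant D) (k : Kash I) (c : X.Cell) : Option X.Cell :=
  Quot.lift (fun p => (ZigZag.act h k p).map (Quot.mk ZigZag.Rel))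
    (fun _ _ hpq => ZigZag.Rel.act h hpq) c

theorem Cell.act_src (h : X.IsEquivariant D) {k : Kash I} {c d : X.Cell} (hd : Cell.act h k c = some d) :
    op (D := D) k c.src = some d.src := by
  induction c using Quot.ind with | mk p
  obtain ⟨q, hq, rfl⟩ := Option.map_eq_some_iff.1 hd
  exact ((ZigZag.act_eq_some_iff h).1 hq).1

theorem Cell.act_tgt (h : X.IsEquivariant D) {k : Kash I} {c d : X.Cell} (hd : Cell.act h k c = some d) :
    op (D := D) k c.tgt = some d.tgt := by
  induction c using Quot.ind with | mk p
  obtain ⟨q, hq, rfl⟩ := Option.map_eq_some_iff.1 hd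
  exact ZigZag.act_finish h hq

/-- The Kashiwara operators on local branchings, `k.(f, g) = (k.f, k.g)`. -/
def LocalBranching.act (h : X.IsEquivariant D) (k : Kash I) (b : X.LocalBranching) : Option X.LocalBranching :=
  match hf : op (D := D) k b.fst, hg : op (D := D) k b.snd with
  | some f, some g => some ⟨f, g, by
      have h1 := op_source h k b.fst
      have h2 := op_source h k b.snd
      rw [b.source_eq, h2, hf, hg] at h1
      exact (Option.some_injective _ h1).symm⟩
  | _, _ => none

theorem LocalBranching.act_eq_some_iff (h : X.IsEquivariant D) {k : Kash I} {b c : X.LocalBranching} :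
    b.act h k = some c ↔
      op (D := D) k b.fst = some c.fst ∧ op (D := D) k b.snd = some c.snd := by
  unfold LocalBranching.act
  split
  next f g hf hg => simp [hf, hg, LocalBranching.ext_iff]
  next hne =>
    simp only [reduceCtorEq, false_iff]
    rintro ⟨h1, h2⟩
    exact hne _ _ h1 h2

end Polygraph

end Equivariant

namespace Polygraph

variable {A R : Type*}

/-- The 2-spheres of `X_2^⊤`: pairs of parallel 2-cells. -/
@[ext]
structure Sphere (X : Polygraph A R) where
  fst : X.Cell
  snd : X.Cell
  src_eq : fst.src = snd.src
  tgt_eq : fst.tgt = snd.tgt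

variable {D} [CrystalData D A] [CrystalData D R] {X : Polygraph A R} (h : X.IsEquivariant D)

/-- The Kashiwara operators on 2-spheres, `k.(f, g) = (k.f, k.g)`. -/
def Sphere.act (k : Kash I) (γ : X.Sphere) : Option X.Sphere :=
  match hf : Cell.act h k γ.fst, hg : Cell.act h k γ.snd with
  | some f, some g => some ⟨f, g, by
      have h1 := Cell.act_src h hf
      rw [γ.src_eq, Cell.act_src h hg] at h1
      exact (Option.some_injective _ h1).symm, by
      have h1 := Cell.act_tgt h hf
      rw [γ.tgt_eq, Cell.act_tgt h hg] at h1
      exact (Option.some_injective _ h1).symm⟩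
  | _, _ => none

theorem Sphere.act_eq_some_iff {k : Kash I} {γ δ : X.Sphere} :
    γ.act h k = some δ ↔ Cell.act h k γ.fst = some δ.fst ∧ Cell.act h k γ.snd = some δ.snd := by
  unfold Sphere.act
  split
  next f g hf hg => simp [hf, hg, Sphere.ext_iff]
  next hne =>
    simp only [reduceCtorEq, false_iff]
    rintro ⟨h1, h2⟩
    exact hne _ _ h1 h2

/-! The crystal structure of the presented monoid. -/

/-- The congruence on words relating words with the same class in the presented monoid, with the
same values of `wt`, `ε_i`, `φ_i`, and with congruent images under the Kashiwara operators. -/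
def actCon : Con (FreeMonoid A) where
  r u v := X.toMon u.toList = X.toMon v.toList ∧ wt (D := D) u.toList = wt v.toList ∧
    (∀ i, eps D i u.toList = eps D i v.toList) ∧ (∀ i, phi D i u.toList = phi D i v.toList) ∧
    ∀ k, (op (D := D) k u.toList).map X.toMon = (op (D := D) k v.toList).map X.toMon
  iseqv := ⟨fun _ => ⟨rfl, rfl, fun _ => rfl, fun _ => rfl, fun _ => rfl⟩,
    fun h => ⟨h.1.symm, h.2.1.symm, fun i => (h.2.2.1 i).symm, fun i => (h.2.2.2.1 i).symm,
      fun k => (h.2.2.2.2 k).symm⟩,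
    fun h g => ⟨h.1.trans g.1, h.2.1.trans g.2.1, fun i => (h.2.2.1 i).trans (g.2.2.1 i),
      fun i => (h.2.2.2.1 i).trans (g.2.2.2.1 i), fun k => (h.2.2.2.2 k).trans (g.2.2.2.2 k)⟩⟩
  mul' := by
    rintro u u' v v' ⟨a1, a2, a3, a4, a5⟩ ⟨b1, b2, b3, b4, b5⟩
    simp only [FreeMonoid.toList_mul]
    refine ⟨?_, ?_, fun i => ?_, fun i => ?_, fun k => ?_⟩
    · rw [toMon_append, toMon_append, a1, b1]
    · rw [wt_append, wt_append, a2, b2]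
    · rw [eps_append, eps_append, a3, a4, b3]
    · rw [phi_append, phi_append, a4, b3, b4]
    · rw [op_append h.gen, op_append h.gen]
      simp only [a4, b3]
      split_ifs
      · have := congrArg (Option.map (· * X.toMon v.toList)) (a5 k)
        simpa [Function.comp_def, toMon_append, b1] using this
      · have := congrArg (Option.map (X.toMon u.toList * ·)) (b5 k)
        simpa [Function.comp_def, toMon_append, a1] using this

theorem conGen_le_actCon : conGen X.relation ≤ actCon h := by
  refine Con.conGen_le.2 ?_
  rintro _ _ ⟨α, rfl, rfl⟩
  refine ⟨X.toMon_src α, ?_, fun i => ?_, fun i => ?_, fun k => ?_⟩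
  · exact (h.src.wt_eq α).trans (h.tgt.wt_eq α).symm
  · exact (h.src.eps_eq i α).trans (h.tgt.eps_eq i α).symm
  · exact (h.src.phi_eq i α).trans (h.tgt.phi_eq i α).symm
  · simp only [FreeMonoid.toList_ofList, h.src.op_eq, h.tgt.op_eq, Option.map_map]
    congr 1
    exact funext fun β => X.toMon_src β

end Polygraph

/-- A crystal 2-polygraph: a 2-polygraph whose generating 1-cells and 2-cells form crystals and
whose source and target maps are morphisms of crystals. -/
structure CrystalPolygraph (A R : Type*) [CrystalData D A] [CrystalData D R] extends
    Polygraph A R where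
  gen_isCrystal : IsCrystal D A
  rule_isCrystal : IsCrystal D R
  src_isHom : IsHom D src
  tgt_isHom : IsHom D tgt

namespace CrystalPolygraph

open Polygraph

variable {D} {A R : Type*} [CrystalData D A] [CrystalData D R] (X : CrystalPolygraph D A R)

theorem isEquivariant : X.IsEquivariant D :=
  ⟨X.gen_isCrystal.toIsNormal, X.src_isHom, X.tgt_isHom⟩

/-- The structure maps of the monoid presented by `X`, induced from those of words. -/
instance mon : CrystalData D X.Mon where
  wt := Quotient.lift (fun w : FreeMonoid A => wt (D := D) w.toList)
    fun _ _ h => (conGen_le_actCon X.isEquivariant h).2.1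
  eps i := Quotient.lift (fun w : FreeMonoid A => eps D i w.toList)
    fun _ _ h => (conGen_le_actCon X.isEquivariant h).2.2.1 i
  phi i := Quotient.lift (fun w : FreeMonoid A => phi D i w.toList)
    fun _ _ h => (conGen_le_actCon X.isEquivariant h).2.2.2.1 i
  op k := Quotient.lift (fun w : FreeMonoid A => (op (D := D) k w.toList).map X.toMon)
    fun _ _ h => (conGen_le_actCon X.isEquivariant h).2.2.2.2 k

/-- The structure maps on local branchings, induced from those of the source. -/
instance branching : CrystalData D X.LocalBranching where
  wt b := wt b.source
  eps i b := eps D i b.source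
  phi i b := phi D i b.source
  op k b := b.act X.isEquivariant k

/-- The structure maps on the 2-cells of `X_2^⊤`, induced from those of the source. -/
instance cell : CrystalData D X.Cell where
  wt c := wt c.src
  eps i c := eps D i c.src
  phi i c := phi D i c.src
  op k c := c.act X.isEquivariant k

/-- The structure maps on the 2-spheres of `X_2^⊤`, induced from those of the source. -/
instance sphere : CrystalData D X.Sphere where
  wt γ := wt γ.fst.src
  eps i γ := eps D i γ.fst.src
  phi i γ := phi D i γ.fst.src
  op k γ := γ.act X.isEquivariant k

end CrystalPolygraph

/-! ### Sections, normalization strategies and generating confluences -/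

namespace Polygraph

variable {A R : Type*}

/-- Sections `r` of the projection from words to the presented monoid, with `r(1) = 1`. -/
structure Section (X : Polygraph A R) where
  toFun : X.Mon → List A
  toMon_toFun : ∀ m, X.toMon (toFun m) = m
  map_one : toFun 1 = []

/-- The representative `ŵ` of a word `w`. -/
def Section.hat {X : Polygraph A R} (r : X.Section) (w : List A) : List A := r.toFun (X.toMon w)

/-- Normalization strategies for the section `r`: a 2-cell `σ_w : w ⟹ ŵ` of `X_2^⊤` for each
word `w`, with `σ_ŵ = 1_ŵ`. -/
structure NormalizationStrategy {X : Polygraph A R} (r : X.Section) where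
  toFun : List A → X.Cell
  src_toFun : ∀ w, (toFun w).src = w
  tgt_toFun : ∀ w, (toFun w).tgt = r.hat w
  toFun_hat : ∀ w, toFun (r.hat w) = Cell.id (r.hat w)

theorem Cell.src_comp {X : Polygraph A R} (c d : X.Cell) : (c.comp d).src = c.src := by
  induction c using Quot.ind with | mk p
  induction d using Quot.ind with | mk q
  change (ZigZag.comp p q).start = p.start
  unfold ZigZag.comp
  split_ifs <;> rfl

theorem Cell.tgt_comp {X : Polygraph A R} (c d : X.Cell) (h : c.tgt = d.src) :
    (c.comp d).tgt = d.tgt := by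
  induction c using Quot.ind with | mk p
  induction d using Quot.ind with | mk q
  have h' : p.finish = q.start := h
  change (ZigZag.comp p q).finish = q.finish
  unfold ZigZag.comp
  rw [dif_pos h']
  change pathEnd p.start (p.steps ++ q.steps) = _
  rw [pathEnd_append]
  change pathEnd p.finish _ = _
  rw [h']
  rfl

theorem Cell.tgt_ofStep {X : Polygraph A R} (s : X.Step) : (Cell.ofStep s).tgt = s.target := rfl

/-- The 2-sphere `(f ⋆₁ σ_{t(f)}, g ⋆₁ σ_{t(g)})` attached to a local branching `(f, g)`. -/
noncomputable def NormalizationStrategy.confluence {X : Polygraph A R} {r : X.Section}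
    (σ : NormalizationStrategy r) (b : X.LocalBranching) : X.Sphere where
  fst := (Cell.ofStep b.fst).comp (σ.toFun b.fst.target)
  snd := (Cell.ofStep b.snd).comp (σ.toFun b.snd.target)
  src_eq := by
    rw [Cell.src_comp, Cell.src_comp]
    exact b.source_eq
  tgt_eq := by
    have key : ∀ s : X.Step,
        ((Cell.ofStep s).comp (σ.toFun s.target)).tgt = r.toFun (X.toMon s.source) := fun s =>
      (Cell.tgt_comp (Cell.ofStep s) (σ.toFun s.target) (σ.src_toFun s.target).symm).trans
        ((σ.tgt_toFun s.target).trans (congrArg r.toFun (X.toMon_source s).symm))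
    rw [key, key, b.source_eq]

/-- The family `Ω` of generating confluences obtained from `r` and `σ`. -/
def NormalizationStrategy.generatingConfluences {X : Polygraph A R} {r : X.Section}
    (σ : NormalizationStrategy r) : Set X.Sphere :=
  {γ | ∃ b ∈ X.Crit, σ.confluence b = γ}

end Polygraph

namespace CrystalPolygraph

open Polygraph

variable {D} {A R : Type*} [CrystalData D A] [CrystalData D R] (X : CrystalPolygraph D A R)

/-- Crystal normalization strategies: `σ_{k.w} = k.σ_w` whenever `k.w ≠ 0`. -/
def IsCrystalStrategy {r : X.Section} (σ : NormalizationStrategy r) : Prop :=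
  ∀ (k : Kash I) (w w' : List A), op (D := D) k w = some w' →
    op (D := D) k (σ.toFun w) = some (σ.toFun w')

end CrystalPolygraph

end Crystal

/-! Every structure in sight (steps, 2-cells, branchings, 2-spheres) takes its weight, `ε_i` and
`φ_i` from its source word, and an operator kills an element exactly when it kills that word. The
source map is therefore a strict morphism to the free crystal monoid, which is normal because tensor
products of normal crystals are. A set with such a morphism inherits all axioms of a normal crystal
except that `e_i` and `f_i` are mutually inverse (`IsNormal.of_hom`). What remains is this
invertibility, the stability of the two subsets, injectivity of the source map on components, and
the existence of highest weight elements.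

Invertibility: a step `t α v` is a word over `A ⊕ R` with one letter from `R`, so it follows from
normality of words (`Step.toWord_isHom`). It passes to 2-cells step by step, and to pairs
componentwise.

Stability: an operator acts on `u s v` through a factor that depends only on `u`, `v` and the source
of `s`, hence through the same factor for both steps of a branching (`op_whisker_cases`). Peiffer
branchings and whiskered branchings thus keep their shape, and criticality is preserved
(`LocalBranching.isCritical_of_act`). Since `k.(f ⋆₁ σ_{t(f)}) = (k.f) ⋆₁ σ_{t(k.f)}`, the map `b ↦
γ_b` is a strict morphism, and `Ω` is stable as the image of a stable set.

Injectivity: operators fix the length of the left context of a step and keep its rule in one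
component of `R`, so two connected steps with equal source cut that word at the same places. Their
rules then agree because a morphism out of a crystal is injective on components
(`IsCrystal.injOnComponents`).

Highest weight elements: linear independence of the simple roots makes the depth of a letter below
its highest weight element well defined. Summed over a word, the depth drops by one under every
`e_i`, so raising stops (`IsHeight.exists_lowersTo`). When the free crystal monoid is itself a
crystal, uniqueness is transported back along the source map (`IsCrystal.of_hom`). -/

/-- The partial inverse of a Kashiwara operator. -/
def Kash.inv {I : Type*} : Kash I → Kash I
  | .e i => .f i
  | .f i => .e i

namespace Crystal

open CrystalData

section General

variable {I : Type*} {D : CartanDatum I} {Γ Δ : Type*} [CrystalData D Γ] [CrystalData D Δ]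

/-! ### Sequences of Kashiwara operators -/

theorem applyOps_append (L M : List (Kash I)) (x : Γ) :
    applyOps D (L ++ M) x = (applyOps D M x).bind (applyOps D L) := by
  induction L with
  | nil => simp [applyOps]
  | cons k L ih =>
    rw [List.cons_append, applyOps, ih]
    cases applyOps D M x <;> rfl

theorem applyOps_singleton (k : Kash I) (x : Γ) : applyOps D [k] x = op (D := D) k x := rfl

theorem applyOps_replicate_succ (k : Kash I) (n : ℕ) (x : Γ) :
    applyOps D (List.replicate (n + 1) k) x =
      (op (D := D) k x).bind (applyOps D (List.replicate n k)) := by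
  rw [List.replicate_succ', applyOps_append, applyOps_singleton]

theorem Connected.refl (x : Γ) : Connected D x x := ⟨[], rfl⟩

theorem Connected.trans {x y z : Γ} (h : Connected D x y) (g : Connected D y z) :
    Connected D x z := by
  obtain ⟨L, hL⟩ := h
  obtain ⟨M, hM⟩ := g
  exact ⟨M ++ L, by rw [applyOps_append, hL]; exact hM⟩

theorem Connected.of_op {k : Kash I} {x y : Γ} (h : op (D := D) k x = some y) :
    Connected D x y := ⟨[k], h⟩

/-- The inverse of `op_k` is `op_{k⁻¹}`. -/
def OpInvertible (D : CartanDatum I) (Γ : Type*) [CrystalData D Γ] : Prop :=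
  ∀ (k : Kash I) (x y : Γ), op (D := D) k x = some y → op (D := D) k.inv y = some x

theorem IsNormal.opInvertible (h : IsNormal D Γ) : OpInvertible D Γ := by
  rintro (i | i) x y hxy
  exacts [(h.e_iff_f x y i).1 hxy, (h.e_iff_f y x i).2 hxy]

theorem OpInvertible.e_iff_f (h : OpInvertible D Γ) (x y : Γ) (i : I) :
    op (D := D) (Kash.e i) x = some y ↔ op (D := D) (Kash.f i) y = some x :=
  ⟨h _ _ _, h _ _ _⟩

theorem OpInvertible.eq_of_op (h : OpInvertible D Γ) {k : Kash I} {x y z : Γ}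
    (hx : op (D := D) k x = some z) (hy : op (D := D) k y = some z) : x = y :=
  Option.some_injective _ ((h _ _ _ hx).symm.trans (h _ _ _ hy))

theorem OpInvertible.applyOps (h : OpInvertible D Γ) {L : List (Kash I)} {x y : Γ}
    (hL : applyOps D L x = some y) : applyOps D (L.map Kash.inv).reverse y = some x := by
  induction L generalizing y with
  | nil => exact (Option.some_injective _ hL) ▸ rfl
  | cons k L ih =>
    obtain ⟨z, hz, hk⟩ := Option.bind_eq_some_iff.1 hL
    rw [List.map_cons, List.reverse_cons, applyOps_append, applyOps_singleton, h _ _ _ hk]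
    exact ih hz

theorem OpInvertible.connected_symm (h : OpInvertible D Γ) {x y : Γ} (hxy : Connected D x y) :
    Connected D y x :=
  let ⟨_, hL⟩ := hxy
  ⟨_, h.applyOps hL⟩

/-! ### Normal crystals -/

/-- The `e_i`-string starting at `x` is `x` followed by the one starting at `y`. -/
theorem IsNormal.eps_of_e (h : IsNormal D Γ) {x y : Γ} {i : I}
    (hxy : op (D := D) (Kash.e i) x = some y) : eps D i x = eps D i y + 1 := by
  refine (h.eps_max x i).unique ⟨?_, ?_⟩
  · rw [Set.mem_ofPred_eq, applyOps_replicate_succ, hxy]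
    exact (h.eps_max y i).1
  · rintro (- | n) hn
    · omega
    · rw [Set.mem_ofPred_eq, applyOps_replicate_succ, hxy] at hn
      exact Nat.succ_le_succ ((h.eps_max y i).2 hn)

theorem IsNormal.phi_of_f (h : IsNormal D Γ) {x y : Γ} {i : I}
    (hxy : op (D := D) (Kash.f i) x = some y) : phi D i x = phi D i y + 1 := by
  refine (h.phi_max x i).unique ⟨?_, ?_⟩
  · rw [Set.mem_ofPred_eq, applyOps_replicate_succ, hxy]
    exact (h.phi_max y i).1
  · rintro (- | n) hn
    · omega
    · rw [Set.mem_ofPred_eq, applyOps_replicate_succ, hxy] at hn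
      exact Nat.succ_le_succ ((h.phi_max y i).2 hn)

theorem IsNormal.e_ne_none (h : IsNormal D Γ) {x : Γ} {i : I} (hx : eps D i x ≠ 0) :
    op (D := D) (Kash.e i) x ≠ none := by
  obtain ⟨n, hn⟩ := Nat.exists_eq_succ_of_ne_zero hx
  have := (h.eps_max x i).1
  rw [Set.mem_ofPred_eq, hn, applyOps_replicate_succ] at this
  intro h0
  simp [h0] at this

theorem IsNormal.f_ne_none (h : IsNormal D Γ) {x : Γ} {i : I} (hx : phi D i x ≠ 0) :
    op (D := D) (Kash.f i) x ≠ none := by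
  obtain ⟨n, hn⟩ := Nat.exists_eq_succ_of_ne_zero hx
  have := (h.phi_max x i).1
  rw [Set.mem_ofPred_eq, hn, applyOps_replicate_succ] at this
  intro h0
  simp [h0] at this

/-- A function on `Γ` that drops by one under `k` and vanishes where `k` does is the length of the
`k`-string. -/
theorem isGreatest_applyOps_replicate {k : Kash I} {m : Γ → ℕ}
    (h1 : ∀ x, m x ≠ 0 → op (D := D) k x ≠ none)
    (hs : ∀ x y, op (D := D) k x = some y → m x = m y + 1) (x : Γ) :
    IsGreatest {n : ℕ | applyOps D (List.replicate n k) x ≠ none} (m x) := by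
  have key : ∀ n x, applyOps D (List.replicate n k) x ≠ none ↔ n ≤ m x := by
    intro n
    induction n with
    | zero => simp [applyOps]
    | succ n ih =>
      intro x
      rw [applyOps_replicate_succ]
      rcases hx : op (D := D) k x with - | y
      · have : m x = 0 := by
          by_contra hm
          exact h1 x hm hx
        simp [this]
      · rw [Option.bind_some, ih, hs x y hx]
        omega
  exact ⟨(key _ _).2 le_rfl, fun n hn => (key _ _).1 hn⟩

/-! ### Morphisms -/

theorem IsHom.comp {Θ : Type*} [CrystalData D Θ] {F : Γ → Δ} {G : Δ → Θ} (hG : IsHom D G)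
    (hF : IsHom D F) : IsHom D (fun x => G (F x)) :=
  ⟨fun x => (hG.wt_eq _).trans (hF.wt_eq x), fun i x => (hG.eps_eq i _).trans (hF.eps_eq i x),
    fun i x => (hG.phi_eq i _).trans (hF.phi_eq i x), fun k x => by
      rw [hG.op_eq, hF.op_eq, Option.map_map]
      rfl⟩

theorem IsHom.applyOps {F : Γ → Δ} (hF : IsHom D F) (L : List (Kash I)) (x : Γ) :
    applyOps D L (F x) = (applyOps D L x).map F := by
  induction L with
  | nil => rfl
  | cons k L ih =>
    rw [Crystal.applyOps, Crystal.applyOps, ih]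
    cases Crystal.applyOps D L x
    · rfl
    · exact hF.op_eq k _

theorem IsHom.isHighestWeight {F : Γ → Δ} (hF : IsHom D F) (x : Γ) :
    IsHighestWeight D (F x) ↔ IsHighestWeight D x :=
  forall_congr' fun i => by rw [hF.op_eq, Option.map_eq_none_iff]

theorem IsHom.connected {F : Γ → Δ} (hF : IsHom D F) {x y : Γ} (h : Connected D x y) :
    Connected D (F x) (F y) :=
  let ⟨L, hL⟩ := h
  ⟨L, by rw [hF.applyOps, hL]; rfl⟩

/-- Path lifting: a strict morphism sends only `0` to `0`, so operators that do not vanish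
downstairs do not vanish upstairs. -/
theorem IsHom.exists_connected {F : Γ → Δ} (hF : IsHom D F) {x : Γ} {w : Δ}
    (h : Connected D (F x) w) : ∃ y, Connected D x y ∧ F y = w := by
  obtain ⟨L, hL⟩ := h
  rw [hF.applyOps] at hL
  obtain ⟨y, hy, rfl⟩ := Option.map_eq_some_iff.1 hL
  exact ⟨y, ⟨L, hy⟩, rfl⟩

theorem OpInvertible.of_hom {F : Γ → Δ} (hF : IsHom D F) (inj : Function.Injective F)
    (h : OpInvertible D Δ) : OpInvertible D Γ := fun k x y hxy => by
  have h1 := h k (F x) (F y) (by rw [hF.op_eq, hxy]; rfl)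
  rw [hF.op_eq] at h1
  obtain ⟨z, hz, e⟩ := Option.map_eq_some_iff.1 h1
  rw [hz, inj e]

/-- A set with invertible operators and a morphism to a normal crystal is a normal crystal. -/
theorem IsNormal.of_hom {F : Γ → Δ} (hF : IsHom D F) (h : IsNormal D Δ) (hΓ : OpInvertible D Γ) :
    IsNormal D Γ := by
  -- Strings upstairs and downstairs break off at the same point, so their maximal lengths agree.
  have key : ∀ k : Kash I, ∀ n x, Crystal.applyOps D (List.replicate n k) (F x) ≠ none ↔
      Crystal.applyOps D (List.replicate n k) x ≠ none := fun k n x => by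
    rw [hF.applyOps, ne_eq, Option.map_eq_none_iff]
  refine ⟨fun x i => ?_, fun x i => ?_, fun x i => ?_, fun x y i hxy => ?_, fun x y i hxy => ?_,
    hΓ.e_iff_f⟩
  · rw [← hF.phi_eq, ← hF.eps_eq, ← hF.wt_eq]
    exact h.phi_sub_eps _ i
  · rw [← hF.eps_eq]
    simpa only [key] using h.eps_max (F x) i
  · rw [← hF.phi_eq]
    simpa only [key] using h.phi_max (F x) i
  · rw [← hF.wt_eq, ← hF.wt_eq]
    exact h.wt_e _ _ i (by rw [hF.op_eq, hxy]; rfl)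
  · rw [← hF.wt_eq, ← hF.wt_eq]
    exact h.wt_f _ _ i (by rw [hF.op_eq, hxy]; rfl)

/-- Injectivity on connected components. -/
def InjOnComponents (D : CartanDatum I) [CrystalData D Γ] (F : Γ → Δ) : Prop :=
  ∀ x y, Connected D x y → F x = F y → x = y

/-- Surjectivity is path lifting. For injectivity, two elements reached from `x` are connected to
each other because operators can be undone. -/
theorem IsHom.bijOn_component {F : Γ → Δ} (hF : IsHom D F) (inj : InjOnComponents D F)
    (h : OpInvertible D Γ) (x : Γ) :
    Set.BijOn F {y | Connected D x y} {w | Connected D (F x) w} :=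
  ⟨fun _ hy => hF.connected hy,
    fun y hy z hz e => inj y z ((h.connected_symm hy).trans hz) e,
    fun _ hw => let ⟨y, hy, e⟩ := hF.exists_connected hw
      ⟨y, hy, e⟩⟩

theorem IsCrystal.of_hom {F : Γ → Δ} (hF : IsHom D F) (inj : InjOnComponents D F)
    (hΓ : OpInvertible D Γ) (h : IsCrystal D Δ) : IsCrystal D Γ := by
  refine ⟨h.toIsNormal.of_hom hF hΓ, fun x => ?_⟩
  have hbij := hF.bijOn_component inj hΓ x
  obtain ⟨w, hw, hdom, huniq, hlow⟩ := h.component (F x)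
  obtain ⟨x₀, hx₀, rfl⟩ := hF.exists_connected hw
  refine ⟨x₀, hx₀, by rwa [← hF.wt_eq], fun y hy => ?_, fun y hy => ?_⟩
  · rw [← hF.isHighestWeight, huniq _ (hF.connected hy)]
    exact ⟨fun e => hbij.injOn hy hx₀ e, fun e => e ▸ rfl⟩
  -- The lowering path downstairs lifts to one starting at `x₀`; its end has the same image as `y`
  -- in the same component, so it is `y`.
  · obtain ⟨L, hL⟩ := hlow _ (hF.connected hy)
    rw [hF.applyOps] at hL
    obtain ⟨z, hz, e⟩ := Option.map_eq_some_iff.1 hL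
    exact ⟨L, hz.trans (congrArg some (hbij.injOn (hx₀.trans ⟨_, hz⟩) hy e))⟩

/-- A morphism from a crystal is injective on components. -/
theorem IsCrystal.injOnComponents (h : IsCrystal D Γ) {F : Γ → Δ} (hF : IsHom D F) :
    InjOnComponents D F := by
  intro x y hxy e
  have hΓ := h.opInvertible
  obtain ⟨x₀, hx₀, -, huniq, hlow⟩ := h.component x
  obtain ⟨L, hL⟩ := hlow x (.refl x)
  -- Reversing the lowering path from `x₀` to `x` gives a raising path `E` with `E.x = x₀`. As `F x
  -- = F y`, also `E.y = z` exists and has the image of `x₀`; hence `z` is of highest weight, and `z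
  -- = x₀` by uniqueness.
  have hE := hΓ.applyOps hL
  have hEF := hF.applyOps ((L.map Kash.f).map Kash.inv).reverse x
  rw [e, hF.applyOps, hE] at hEF
  obtain ⟨z, hz, ez⟩ := Option.map_eq_some_iff.1 hEF
  have hz₀ : z = x₀ := (huniq z (hxy.trans ⟨_, hz⟩)).1 <| by
    rw [← hF.isHighestWeight, ez, hF.isHighestWeight]
    exact (huniq x₀ hx₀).2 rfl
  subst hz₀
  -- Undoing `E` from the common end recovers both `x` and `y`.
  have h1 := hΓ.applyOps hz
  have h2 := hΓ.applyOps hE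
  exact Option.some_injective _ (h2.symm.trans h1)

/-! ### Subsets -/

/-- Stability means that the truncation to `0` in the restricted operators never occurs. -/
theorem restrict_isHom {S : Set Γ}
    (hS : ∀ (k : Kash I) (x y : Γ), x ∈ S → op (D := D) k x = some y → y ∈ S) :
    IsHom D (Subtype.val : S → Γ) := by
  refine ⟨fun _ => rfl, fun _ _ => rfl, fun _ _ => rfl, fun k x => ?_⟩
  change _ = ((op (D := D) k x.1).bind _).map _
  rcases hx : op (D := D) k x.1 with - | y
  · rfl
  · simp [hS k x y x.2 hx]

end General

section Words

variable {I : Type*} {D : CartanDatum I} {Γ Δ : Type*} [CrystalData D Γ] [CrystalData D Δ]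

/-! ### Words over a normal crystal -/

theorem eps_cons (i : I) (x : Γ) (w : List Γ) :
    eps D i (x :: w) = eps D i x + (eps D i w - phi D i x) := rfl

theorem phi_cons (i : I) (x : Γ) (w : List Γ) :
    phi D i (x :: w) = phi D i w + (phi D i x - eps D i w) := rfl

theorem wt_cons (x : Γ) (w : List Γ) : wt (D := D) (x :: w) = wt x + wt w := rfl

theorem op_cons (k : Kash I) (x : Γ) (w : List Γ) : op (D := D) k (x :: w) =
    if ActsLeft k (fun i => phi D i x) (fun i => eps D i w) then
      (op (D := D) k x).map fun y => y :: w
    else (op (D := D) k w).map fun v => x :: v := rfl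

theorem op_e_cons (i : I) (x : Γ) (w : List Γ) : op (D := D) (.e i) (x :: w) =
    if eps D i w ≤ phi D i x then (op (D := D) (.e i) x).map fun y => y :: w
    else (op (D := D) (.e i) w).map fun v => x :: v := op_cons _ _ _

theorem op_f_cons (i : I) (x : Γ) (w : List Γ) : op (D := D) (.f i) (x :: w) =
    if eps D i w < phi D i x then (op (D := D) (.f i) x).map fun y => y :: w
    else (op (D := D) (.f i) w).map fun v => x :: v := op_cons _ _ _

theorem length_op {k : Kash I} {w w' : List Γ} (h : op (D := D) k w = some w') :
    w'.length = w.length := by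
  induction w generalizing w' with
  | nil => cases h
  | cons x w ih =>
    rw [op_cons] at h
    split_ifs at h <;> obtain ⟨y, hy, rfl⟩ := Option.map_eq_some_iff.1 h
    · rfl
    · simp [ih hy]

/-- `f_i` acts on the letter that `e_i` has just changed: on the left, `φ_i` of the letter has
risen, so `ε_i(w) ≤ φ_i(x)` becomes strict; on the right, `ε_i` of the tail has dropped by one and
is still at least `φ_i(x)`. These comparisons use the changes of `ε_i` and `φ_i`, so all the claims
go through one induction. -/
theorem word_e (h : IsNormal D Γ) (i : I) {w w' : List Γ}
    (hw : op (D := D) (.e i) w = some w') :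
    op (D := D) (.f i) w' = some w ∧ eps D i w = eps D i w' + 1 ∧
      phi D i w' = phi D i w + 1 ∧ wt (D := D) w' = wt w + D.root i := by
  induction w generalizing w' with
  | nil => cases hw
  | cons x w ih =>
    rw [op_e_cons] at hw
    split_ifs at hw with hc <;> obtain ⟨y, hy, rfl⟩ := Option.map_eq_some_iff.1 hw
    · have h1 := h.eps_of_e hy
      have hf := (h.e_iff_f _ _ _).1 hy
      have h2 := h.phi_of_f hf
      refine ⟨?_, ?_, ?_, ?_⟩
      · rw [op_f_cons, if_pos (by omega), hf]
        rfl
      · rw [eps_cons, eps_cons]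
        omega
      · rw [phi_cons, phi_cons]
        omega
      · rw [wt_cons, wt_cons, h.wt_e _ _ _ hy]
        abel
    · obtain ⟨h0, h1, h2, h3⟩ := ih hy
      refine ⟨?_, ?_, ?_, ?_⟩
      · rw [op_f_cons, if_neg (by omega), h0]
        rfl
      · rw [eps_cons, eps_cons]
        omega
      · rw [phi_cons, phi_cons]
        omega
      · rw [wt_cons, wt_cons, h3]
        abel

theorem word_e_of_f (h : IsNormal D Γ) (i : I) {w w' : List Γ}
    (hw : op (D := D) (.f i) w = some w') : op (D := D) (.e i) w' = some w := by
  induction w generalizing w' with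
  | nil => cases hw
  | cons x w ih =>
    rw [op_f_cons] at hw
    split_ifs at hw with hc <;> obtain ⟨y, hy, rfl⟩ := Option.map_eq_some_iff.1 hw
    · have h2 := h.phi_of_f hy
      rw [op_e_cons, if_pos (by omega), (h.e_iff_f _ _ _).2 hy]
      rfl
    · have h0 := ih hy
      have h1 := (word_e h i h0).2.1
      rw [op_e_cons, if_neg (by omega), h0]
      rfl

theorem word_e_ne_none (h : IsNormal D Γ) {w : List Γ} {i : I} (hw : eps D i w ≠ 0) :
    op (D := D) (.e i) w ≠ none := by
  induction w with
  | nil => exact absurd rfl hw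
  | cons x w ih =>
    rw [eps_cons] at hw
    rw [op_e_cons]
    split_ifs with hc <;> rw [ne_eq, Option.map_eq_none_iff]
    · exact h.e_ne_none (by omega)
    · exact ih (by omega)

theorem word_f_ne_none (h : IsNormal D Γ) {w : List Γ} {i : I} (hw : phi D i w ≠ 0) :
    op (D := D) (.f i) w ≠ none := by
  induction w with
  | nil => exact absurd rfl hw
  | cons x w ih =>
    rw [phi_cons] at hw
    rw [op_f_cons]
    split_ifs with hc <;> rw [ne_eq, Option.map_eq_none_iff]
    · exact h.f_ne_none (by omega)
    · exact ih (by omega)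

/-- The free crystal monoid on a normal crystal is a normal crystal. -/
theorem IsNormal.word (h : IsNormal D Γ) : IsNormal D (List Γ) := by
  refine ⟨fun w i => ?_, fun w i => ?_, fun w i => ?_, fun x y i hxy => ?_, fun x y i hxy => ?_,
    fun x y i => ⟨fun hxy => (word_e h i hxy).1, fun hxy => word_e_of_f h i hxy⟩⟩
  · induction w with
    | nil => exact (map_zero (D.coroot i)).symm
    | cons x w ih =>
      have := h.phi_sub_eps x i
      rw [wt_cons, map_add, ← this, ← ih, eps_cons, phi_cons]
      omega
  · exact isGreatest_applyOps_replicate (fun _ => word_e_ne_none h)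
      (fun _ _ hxy => (word_e h i hxy).2.1) w
  · exact isGreatest_applyOps_replicate (fun _ => word_f_ne_none h)
      (fun _ _ hxy => (word_e h i (word_e_of_f h i hxy)).2.2.1) w
  · exact (word_e h i hxy).2.2.2
  · rw [(word_e h i (word_e_of_f h i hxy)).2.2.2]
    abel

/-- Applying a morphism letter by letter is a morphism. -/
theorem IsHom.listMap {F : Γ → Δ} (hF : IsHom D F) : IsHom D (List.map F) := by
  have key : ∀ i (w : List Γ), eps D i (w.map F) = eps D i w ∧ phi D i (w.map F) = phi D i w := by
    intro i w
    induction w with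
    | nil => exact ⟨rfl, rfl⟩
    | cons x w ih =>
      simp only [List.map_cons, eps_cons, phi_cons, hF.eps_eq, hF.phi_eq, ih, and_self]
  refine ⟨fun w => ?_, fun i w => (key i w).1, fun i w => (key i w).2, fun k w => ?_⟩
  · induction w with
    | nil => rfl
    | cons x w ih => rw [List.map_cons, wt_cons, wt_cons, ih, hF.wt_eq]
  · induction w with
    | nil => rfl
    | cons x w ih =>
      simp only [List.map_cons, op_cons, hF.phi_eq, (key _ w).1, hF.op_eq, ih]
      split_ifs <;> simp [Function.comp_def]

/-! ### Disjoint unions of crystals -/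

theorem inl_isHom : IsHom D (Sum.inl : Γ → Γ ⊕ Δ) :=
  ⟨fun _ => rfl, fun _ _ => rfl, fun _ _ => rfl, fun _ _ => rfl⟩

theorem inr_isHom : IsHom D (Sum.inr : Δ → Γ ⊕ Δ) :=
  ⟨fun _ => rfl, fun _ _ => rfl, fun _ _ => rfl, fun _ _ => rfl⟩

/-- Serves for the alphabet `A ⊕ R`, over which steps become words, and for the rules `R ⊕ R` of
`X^±`. -/
theorem IsNormal.sum (h : IsNormal D Γ) (g : IsNormal D Δ) : IsNormal D (Γ ⊕ Δ) := by
  have hl := (inl_isHom (D := D) (Γ := Γ) (Δ := Δ)).applyOps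
  have hr := (inr_isHom (D := D) (Γ := Γ) (Δ := Δ)).applyOps
  refine ⟨?_, ?_, ?_, ?_, ?_, ?_⟩
  · rintro (x | x) i
    exacts [h.phi_sub_eps x i, g.phi_sub_eps x i]
  · rintro (x | x) i
    · simpa [hl, eps, phi] using h.eps_max x i
    · simpa [hr, eps, phi] using g.eps_max x i
  · rintro (x | x) i
    · simpa [hl, eps, phi] using h.phi_max x i
    · simpa [hr, eps, phi] using g.phi_max x i
  · rintro (x | x) y i hxy <;> obtain ⟨z, hz, rfl⟩ := Option.map_eq_some_iff.1 hxy
    exacts [h.wt_e x z i hz, g.wt_e x z i hz]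
  · rintro (x | x) y i hxy <;> obtain ⟨z, hz, rfl⟩ := Option.map_eq_some_iff.1 hxy
    exacts [h.wt_f x z i hz, g.wt_f x z i hz]
  · rintro (x | x) (y | y) i
    · simpa [op] using h.e_iff_f x y i
    · simp [op]
    · simp [op]
    · simpa [op] using g.e_iff_f x y i

/-! ### Heights -/

/-- `n` drops along every `e_i`. -/
def IsHeight (D : CartanDatum I) [CrystalData D Γ] (n : Γ → ℕ) : Prop :=
  ∀ (x y : Γ) (i : I), op (D := D) (.e i) x = some y → n x = n y + 1

/-- Lists of simple roots with the same sum have the same length. -/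
theorem length_eq_of_sum_root_eq {L M : List I}
    (h : (L.map D.root).sum = (M.map D.root).sum) : L.length = M.length := by
  -- Both the sum of roots and the length are linear in the vector of multiplicities; linear
  -- independence recovers this vector from the former.
  have key : ∀ L : List I, (L.map D.root).sum =
      Finsupp.linearCombination ℤ D.root (L.map fun i => Finsupp.single i (1 : ℤ)).sum := by
    intro L
    simp [map_list_sum, Function.comp_def]
  have len : ∀ L : List I, (L.length : ℤ) =
      Finsupp.linearCombination ℤ (fun _ => (1 : ℤ))
        (L.map fun i => Finsupp.single i (1 : ℤ)).sum := by
    intro L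
    simp [map_list_sum, Function.comp_def]
  rw [key, key] at h
  have := D.root_indep h
  exact_mod_cast (len L).trans ((congrArg _ this).trans (len M).symm)

theorem IsNormal.wt_lower (h : IsNormal D Γ) {x y : Γ} {L : List I}
    (hL : applyOps D (L.map Kash.f) x = some y) :
    wt (D := D) x = wt y + (L.map D.root).sum := by
  induction L generalizing y with
  | nil => simp [Option.some_injective _ hL]
  | cons i L ih =>
    obtain ⟨z, hz, hi⟩ := Option.bind_eq_some_iff.1 hL
    rw [ih hz, h.wt_f _ _ _ hi, List.map_cons, List.sum_cons]
    abel

/-- The depth of an element below the highest weight element of its component is a height. -/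
theorem IsCrystal.exists_isHeight (h : IsCrystal D Γ) : ∃ n : Γ → ℕ, IsHeight D n := by
  choose r hc _ huniq hlow using h.component
  have hr : ∀ x y, Connected D x y → r y = r x := fun x y hxy =>
    (huniq x _ (hxy.trans (hc y))).1 ((huniq y _ (hc y)).2 rfl)
  -- The path `L x` is a choice, but its roots add up to `wt (r x) - wt x`, which fixes its length.
  choose L hL using fun x => hlow x x (.refl x)
  refine ⟨fun x => (L x).length, fun x y i hxy => ?_⟩
  have h1 := h.wt_lower (hL x)
  have h2 := h.wt_lower (hL y)
  rw [hr x y (.of_op hxy), h.wt_e _ _ _ hxy] at h2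
  refine length_eq_of_sum_root_eq (D := D) (M := i :: L y) ?_
  rw [h1, add_assoc] at h2
  simpa using h2

theorem IsHeight.word {n : Γ → ℕ} (h : IsHeight D n) :
    IsHeight D (fun w : List Γ => (w.map n).sum) := by
  intro w w' i hw
  induction w generalizing w' with
  | nil => cases hw
  | cons x w ih =>
    rw [op_e_cons] at hw
    split_ifs at hw <;> obtain ⟨y, hy, rfl⟩ := Option.map_eq_some_iff.1 hw
    · have := h _ _ _ hy
      simp
      omega
    · have := ih _ hy
      simp only [List.map_cons, List.sum_cons] at this ⊢
      omega

theorem IsHeight.of_hom {F : Γ → Δ} (hF : IsHom D F) {n : Δ → ℕ} (h : IsHeight D n) :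
    IsHeight D (fun x => n (F x)) :=
  fun _ _ i hxy => h _ _ i (by rw [hF.op_eq, hxy]; rfl)

/-- In the presence of a height every element is reached from one of highest weight. -/
theorem IsHeight.exists_lowersTo {n : Γ → ℕ} (h : IsHeight D n) (hΓ : OpInvertible D Γ) (x : Γ) :
    ∃ x₀, IsHighestWeight D x₀ ∧ LowersTo D x₀ x := by
  induction hm : n x generalizing x with
  | zero =>
    refine ⟨x, fun i => ?_, [], rfl⟩
    by_contra hne
    obtain ⟨y, hy⟩ := Option.ne_none_iff_exists'.1 hne
    have := h _ _ _ hy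
    omega
  | succ m ih =>
    by_cases hx : IsHighestWeight D x
    · exact ⟨x, hx, [], rfl⟩
    · obtain ⟨i, hi⟩ := not_forall.1 hx
      obtain ⟨y, hy⟩ := Option.ne_none_iff_exists'.1 hi
      have hxy := h _ _ _ hy
      obtain ⟨x₀, hx₀, L, hL⟩ := ih y (by omega)
      refine ⟨x₀, hx₀, i :: L, ?_⟩
      rw [List.map_cons, applyOps, hL]
      exact hΓ _ _ _ hy

end Words

namespace Polygraph

variable {I : Type*} {D : CartanDatum I} {A R : Type*} [CrystalData D A] [CrystalData D R]
  {X : Polygraph A R}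

/-! ### Operators on rewriting steps -/

/-- A step `t α v` as a word with letters in `A ⊕ R`. -/
def Step.toWord (s : X.Step) : List (A ⊕ R) :=
  s.left.map Sum.inl ++ Sum.inr s.rule :: s.right.map Sum.inl

/-- The only letter from `R` marks where the left context ends. -/
theorem Step.toWord_injective : Function.Injective (Step.toWord (X := X)) := by
  rintro ⟨t, α, v⟩ ⟨t', α', v'⟩ h
  simp only [toWord] at h
  induction t generalizing t' with
  | nil =>
    cases t' with
    | nil => simpa [List.map_inj_right Sum.inl_injective] using h
    | cons => simp at h
  | cons x t ih =>
    cases t' with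
    | nil => simp at h
    | cons y t' =>
      simp only [List.map_cons, List.cons_append, List.cons.injEq, Sum.inl.injEq] at h
      have := ih t' h.2
      simp only [Step.mk.injEq] at this ⊢
      exact ⟨by rw [h.1, this.1], this.2⟩

theorem Step.source_isHom (h : X.IsEquivariant D) : IsHom D (Step.source (X := X)) :=
  ⟨fun _ => rfl, fun _ _ => rfl, fun _ _ => rfl, op_source h⟩

theorem eps_step (h : X.IsEquivariant D) (i : I) (t : List A) (α : R) (v : List A) :
    eps D i (⟨t, α, v⟩ : X.Step) =
      eps D i t + (eps D i α + (eps D i v - phi D i α) - phi D i t) := by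
  change eps D i ((t ++ X.src α) ++ v) = _
  rw [List.append_assoc, eps_append, eps_append, h.src.eps_eq, h.src.phi_eq]

theorem phi_step (h : X.IsEquivariant D) (i : I) (t : List A) (α : R) (v : List A) :
    phi D i (⟨t, α, v⟩ : X.Step) = phi D i v + (phi D i α - eps D i v) +
      (phi D i t - (eps D i α + (eps D i v - phi D i α))) := by
  change phi D i ((t ++ X.src α) ++ v) = _
  rw [List.append_assoc, phi_append, phi_append, eps_append, h.src.eps_eq, h.src.phi_eq]

/-- A rule has the same `ε_i`, `φ_i` and weight as its source word, so in the tensor product rule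
the letter `α` can stand in for `s(α)`. -/
theorem Step.toWord_isHom (h : X.IsEquivariant D) (hR : IsNormal D R) :
    IsHom D (Step.toWord (X := X)) := by
  have hl := (inl_isHom (D := D) (Γ := A) (Δ := R)).listMap
  refine ⟨?_, ?_, ?_, ?_⟩
  · rintro ⟨t, α, v⟩
    change _ = wt (D := D) ((t ++ X.src α) ++ v)
    rw [toWord, wt_append, wt_append, wt_append, wt_cons, hl.wt_eq, hl.wt_eq, h.src.wt_eq,
      inr_isHom.wt_eq, add_assoc]
  · rintro i ⟨t, α, v⟩
    rw [eps_step h, toWord, eps_append, eps_cons, hl.eps_eq, hl.phi_eq, hl.eps_eq,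
      inr_isHom.eps_eq, inr_isHom.phi_eq]
  · rintro i ⟨t, α, v⟩
    rw [phi_step h, toWord, phi_append, phi_cons, eps_cons, hl.phi_eq, hl.eps_eq, hl.phi_eq,
      inr_isHom.eps_eq, inr_isHom.phi_eq]
  · rintro k ⟨t, α, v⟩
    rw [op_step, toWord, op_append (h.gen.sum hR), op_cons]
    simp only [eps_append, eps_cons, h.src.eps_eq, h.src.phi_eq, hl.eps_eq, hl.phi_eq, hl.op_eq,
      inr_isHom.eps_eq, inr_isHom.phi_eq, inr_isHom.op_eq]
    split_ifs <;> simp [Function.comp_def, toWord]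

theorem Step.opInvertible (h : X.IsEquivariant D) (hR : IsNormal D R) :
    OpInvertible D X.Step :=
  .of_hom (toWord_isHom h hR) toWord_injective (h.gen.sum hR).word.opInvertible

theorem Step.toWord_whisker (s : X.Step) (u v : List A) :
    (s.whisker u v).toWord = u.map Sum.inl ++ s.toWord ++ v.map Sum.inl := by
  simp [toWord, whisker]

/-- Under `Step.toWord` whiskering becomes concatenation, so this is the tensor product rule for
words. -/
theorem op_whisker_right (h : X.IsEquivariant D) (hR : IsNormal D R) (k : Kash I) (s : X.Step)
    (v : List A) : op (D := D) k (s.whisker [] v) =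
      if ActsLeft k (fun i => phi D i s.source) (fun i => eps D i v) then
        (op (D := D) k s).map fun s' => s'.whisker [] v
      else (op (D := D) k v).map fun v' => s.whisker [] v' := by
  have hw := Step.toWord_isHom h hR
  have hl := (inl_isHom (D := D) (Γ := A) (Δ := R)).listMap
  apply Option.map_injective Step.toWord_injective
  rw [← hw.op_eq, Step.toWord_whisker, op_append (h.gen.sum hR), List.map_nil, List.nil_append]
  simp only [hw.phi_eq, hl.eps_eq, hw.op_eq, hl.op_eq]
  simp only [(Step.source_isHom h).phi_eq]
  split_ifs <;> simp [Function.comp_def, Step.toWord_whisker]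

theorem op_whisker_left (h : X.IsEquivariant D) (hR : IsNormal D R) (k : Kash I) (s : X.Step)
    (u : List A) : op (D := D) k (s.whisker u []) =
      if ActsLeft k (fun i => phi D i u) (fun i => eps D i s.source) then
        (op (D := D) k u).map fun u' => s.whisker u' []
      else (op (D := D) k s).map fun s' => s'.whisker u [] := by
  have hw := Step.toWord_isHom h hR
  have hl := (inl_isHom (D := D) (Γ := A) (Δ := R)).listMap
  apply Option.map_injective Step.toWord_injective
  rw [← hw.op_eq, Step.toWord_whisker, List.map_nil, List.append_nil, op_append (h.gen.sum hR)]
  simp only [hw.eps_eq, hl.phi_eq, hw.op_eq, hl.op_eq]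
  simp only [(Step.source_isHom h).eps_eq]
  split_ifs <;> simp [Function.comp_def, Step.toWord_whisker]

theorem Step.whisker_eq (s : X.Step) (u v : List A) :
    s.whisker u v = (s.whisker [] v).whisker u [] := by
  simp [whisker]

theorem Step.source_whisker (s : X.Step) (u v : List A) :
    (s.whisker u v).source = u ++ s.source ++ v := by
  simp [whisker, source]

/-- An operator acts on `u s v` through the same factor for all steps `s` with the same source. -/
theorem op_whisker_cases (h : X.IsEquivariant D) (hR : IsNormal D R) (k : Kash I)
    (u w v : List A) :
    (∀ s : X.Step, s.source = w →
      op (D := D) k (s.whisker u v) = (op (D := D) k u).map fun u' => s.whisker u' v) ∨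
    (∀ s : X.Step, s.source = w →
      op (D := D) k (s.whisker u v) = (op (D := D) k s).map fun s' => s'.whisker u v) ∨
    (∀ s : X.Step, s.source = w →
      op (D := D) k (s.whisker u v) = (op (D := D) k v).map fun v' => s.whisker u v') := by
  by_cases h1 : ActsLeft k (fun i => phi D i u) (fun i => eps D i (w ++ v))
  · left
    rintro s rfl
    rw [Step.whisker_eq, op_whisker_left h hR, Step.source_whisker, List.nil_append, if_pos h1]
    simp only [← Step.whisker_eq]
  · right
    by_cases h2 : ActsLeft k (fun i => phi D i w) (fun i => eps D i v)
    · left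
      rintro s rfl
      rw [Step.whisker_eq, op_whisker_left h hR, Step.source_whisker, List.nil_append, if_neg h1,
        op_whisker_right h hR, if_pos h2, Option.map_map]
      simp only [Function.comp_def, ← Step.whisker_eq]
    · right
      rintro s rfl
      rw [Step.whisker_eq, op_whisker_left h hR, Step.source_whisker, List.nil_append, if_neg h1,
        op_whisker_right h hR, if_neg h2, Option.map_map]
      simp only [Function.comp_def, ← Step.whisker_eq]

/-- These are the two invariants that locate a step inside its source word. -/
theorem Step.op_components {k : Kash I} {s s' : X.Step}
    (hs : op (D := D) k s = some s') :
    s'.left.length = s.left.length ∧ Connected D s.rule s'.rule := by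
  obtain ⟨t, α, v⟩ := s
  rw [op_step] at hs
  split_ifs at hs <;> obtain ⟨y, hy, rfl⟩ := Option.map_eq_some_iff.1 hs
  · exact ⟨length_op hy, .refl _⟩
  · exact ⟨rfl, .of_op hy⟩
  · exact ⟨rfl, .refl _⟩

theorem Step.applyOps_components {L : List (Kash I)} {s s' : X.Step}
    (hs : applyOps D L s = some s') :
    s'.left.length = s.left.length ∧ Connected D s.rule s'.rule := by
  induction L generalizing s' with
  | nil => exact (Option.some_injective _ hs) ▸ ⟨rfl, .refl _⟩
  | cons k L ih =>
    obtain ⟨z, hz, hk⟩ := Option.bind_eq_some_iff.1 hs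
    obtain ⟨h1, h2⟩ := ih hz
    obtain ⟨h3, h4⟩ := Step.op_components hk
    exact ⟨h3.trans h1, h2.trans h4⟩

theorem length_applyOps {L : List (Kash I)} {w w' : List A} (hw : applyOps D L w = some w') :
    w'.length = w.length := by
  induction L generalizing w' with
  | nil => exact (Option.some_injective _ hw) ▸ rfl
  | cons k L ih =>
    obtain ⟨z, hz, hk⟩ := Option.bind_eq_some_iff.1 hw
    exact (length_op hk).trans (ih hz)

/-- Sources of connected rules have equal length, so equal source words are cut into the same three
pieces. The rules are then connected with the same source, and `R` is a crystal. -/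
theorem Step.source_injOnComponents (h : X.IsEquivariant D) (hR : IsCrystal D R) :
    InjOnComponents D (Step.source (X := X)) := by
  rintro ⟨t, α, v⟩ ⟨t', α', v'⟩ ⟨L, hL⟩ e
  obtain ⟨h1, h2⟩ := Step.applyOps_components hL
  have hlen : ∀ β β', Connected D β β' → (X.src β').length = (X.src β).length := by
    rintro β β' hc
    obtain ⟨M, hM⟩ := h.src.connected hc
    exact length_applyOps hM
  simp only [source] at e h1 h2
  have h3 := List.append_inj e (by simp [h1, hlen _ _ h2])
  have h4 := List.append_inj h3.1 h1.symm
  simp only [Step.mk.injEq]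
  exact ⟨h4.1, hR.injOnComponents h.src _ _ h2 h4.2, h3.2⟩

/-! ### Operators on 2-cells -/

/-- `List.filterMap` discards nothing here: an operator that is nonzero on the initial word is
nonzero on every step of the path, since source and target of a step vanish together with it. -/
theorem filterMap_op_inv (h : X.IsEquivariant D) (hR : OpInvertible D X.Step) {k : Kash I}
    {w w' : List A} (hw : op (D := D) k w = some w') {L : List X.Step} (hL : IsPath w L) :
    (L.filterMap (op (D := D) k)).filterMap (op (D := D) k.inv) = L := by
  induction L generalizing w w' with
  | nil => rfl
  | cons s L ih =>
    obtain ⟨hs, hL⟩ := hL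
    have h1 := op_source h k s
    have h2 := op_target h k s
    rw [hs, hw] at h1
    obtain ⟨s', hs', -⟩ := Option.map_eq_some_iff.1 h1.symm
    rw [hs'] at h2
    rw [List.filterMap_cons_some hs', List.filterMap_cons_some (hR _ _ _ hs'), ih h2 hL]

theorem Cell.act_inv (h : X.IsEquivariant D) (hR : IsNormal D R) {k : Kash I} {c d : X.Cell}
    (hd : Cell.act h k c = some d) : Cell.act h k.inv d = some c := by
  induction c using Quot.ind with | mk p
  obtain ⟨q, hq, rfl⟩ := Option.map_eq_some_iff.1 hd
  obtain ⟨h1, h2⟩ := (ZigZag.act_eq_some_iff h).1 hq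
  refine Option.map_eq_some_iff.2 ⟨p, (ZigZag.act_eq_some_iff h).2
    ⟨h.gen.word.opInvertible _ _ _ h1, ?_⟩, rfl⟩
  rw [h2, filterMap_op_inv h.pm (Step.opInvertible h.pm (hR.sum hR)) h1 p.isPath]

theorem Cell.op_src (h : X.IsEquivariant D) (k : Kash I) (c : X.Cell) :
    op (D := D) k c.src = (Cell.act h k c).map Cell.src := by
  rcases hc : Cell.act h k c with - | d
  · induction c using Quot.ind with | mk p
    exact (ZigZag.act_eq_none_iff h).1 (Option.map_eq_none_iff.1 hc)
  · exact Cell.act_src h hc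

theorem Cell.act_comp (h : X.IsEquivariant D) {k : Kash I} {c c' d d' : X.Cell}
    (hcd : c.tgt = d.src) (hc : Cell.act h k c = some c') (hd : Cell.act h k d = some d') :
    Cell.act h k (c.comp d) = some (c'.comp d') := by
  have hcd' : c'.tgt = d'.src := by
    have := Cell.act_tgt h hc
    rw [hcd, Cell.act_src h hd] at this
    exact (Option.some_injective _ this).symm
  induction c using Quot.ind with | mk p
  induction d using Quot.ind with | mk q
  obtain ⟨p', hp, rfl⟩ := Option.map_eq_some_iff.1 hc
  obtain ⟨q', hq, rfl⟩ := Option.map_eq_some_iff.1 hd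
  obtain ⟨hp1, hp2⟩ := (ZigZag.act_eq_some_iff h).1 hp
  obtain ⟨-, hq2⟩ := (ZigZag.act_eq_some_iff h).1 hq
  refine Option.map_eq_some_iff.2 ⟨p'.comp q', (ZigZag.act_eq_some_iff h).2 ?_, rfl⟩
  -- Composability before and after the action excludes the default value of `ZigZag.comp`.
  have e : p.finish = q.start := hcd
  have e' : p'.finish = q'.start := hcd'
  rw [ZigZag.comp, ZigZag.comp, dif_pos e, dif_pos e']
  refine ⟨hp1, ?_⟩
  rw [List.filterMap_append, ← hp2, ← hq2]

theorem op_pm_inl {k : Kash I} {s s' : X.Step}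
    (hs : op (D := D) k s = some s') :
    op (D := D) k (⟨s.left, Sum.inl s.rule, s.right⟩ : X.pm.Step) =
      some ⟨s'.left, Sum.inl s'.rule, s'.right⟩ := by
  obtain ⟨t, α, v⟩ := s
  rw [op_step] at hs ⊢
  change (if ActsLeft k (fun i => phi D i t) (fun i => eps D i (X.src α ++ v)) then _
    else if ActsLeft k (fun i => phi D i (X.src α)) (fun i => eps D i v) then
    ((op (D := D) k α).map Sum.inl).map _ else _) = _
  split_ifs at hs ⊢ <;> obtain ⟨y, hy, rfl⟩ := Option.map_eq_some_iff.1 hs <;> rw [hy] <;> rfl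

theorem Cell.act_ofStep (h : X.IsEquivariant D) {k : Kash I} {s s' : X.Step}
    (hs : op (D := D) k s = some s') : Cell.act h k (Cell.ofStep s) = some (Cell.ofStep s') := by
  refine Option.map_eq_some_iff.2 ⟨_, (ZigZag.act_eq_some_iff h).2 ⟨?_, ?_⟩, rfl⟩
  · exact (op_source h k s).trans (by rw [hs]; rfl)
  · exact (List.filterMap_cons_some (l := []) (op_pm_inl hs)).symm

/-! ### Operators on local branchings -/

theorem LocalBranching.act_inv (h : X.IsEquivariant D) (hR : IsNormal D R) {k : Kash I}
    {b c : X.LocalBranching} (hc : b.act h k = some c) : c.act h k.inv = some b := by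
  have hS := Step.opInvertible h hR
  rw [act_eq_some_iff] at hc ⊢
  exact ⟨hS _ _ _ hc.1, hS _ _ _ hc.2⟩

/-- An operator that is nonzero on the common source is nonzero on both steps, and their images
again share a source. -/
theorem LocalBranching.op_source (h : X.IsEquivariant D) (k : Kash I) (b : X.LocalBranching) :
    op (D := D) k b.source = (b.act h k).map LocalBranching.source := by
  rcases hc : b.act h k with - | c
  · by_contra hne
    obtain ⟨w, hw⟩ := Option.ne_none_iff_exists'.1 hne
    have h1 := hw
    have h2 : op (D := D) k b.snd.source = some w := b.source_eq ▸ hw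
    rw [source, Polygraph.op_source h] at h1
    rw [Polygraph.op_source h] at h2
    obtain ⟨f, hf, ef⟩ := Option.map_eq_some_iff.1 h1
    obtain ⟨g, hg, eg⟩ := Option.map_eq_some_iff.1 h2
    have := (act_eq_some_iff (c := ⟨f, g, ef.trans eg.symm⟩) h).2 ⟨hf, hg⟩
    rw [hc] at this
    cases this
  · rw [source, Polygraph.op_source h, ((act_eq_some_iff h).1 hc).1]
    rfl

/-- On both `f v` and `u g` the operator chooses between the factors of the same word `uv`. If it
acts on `u`, it replaces `f` by `k.f` and the context `u` of `g` by the source of `k.f`; acting on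
`v` is symmetric. -/
theorem LocalBranching.isPeiffer_of_act (h : X.IsEquivariant D) (hR : IsNormal D R) {k : Kash I}
    {b c : X.LocalBranching} (hc : b.act h k = some c) (hb : b.IsPeiffer) : c.IsPeiffer := by
  obtain ⟨c₁, c₂⟩ := (act_eq_some_iff h).1 hc
  obtain ⟨f, g, hfg⟩ := hb
  have key : ∀ s t : X.Step, op (D := D) k (f.whisker [] g.source) = some s →
      op (D := D) k (g.whisker f.source []) = some t →
      ∃ f' g' : X.Step, s = f'.whisker [] g'.source ∧ t = g'.whisker f'.source [] := by
    intro s t hs ht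
    rw [op_whisker_right h hR] at hs
    rw [op_whisker_left h hR, Polygraph.op_source h k f] at ht
    rw [Polygraph.op_source h k g] at hs
    split_ifs at hs ht
    · obtain ⟨f', hf, rfl⟩ := Option.map_eq_some_iff.1 hs
      rw [hf] at ht
      exact ⟨f', g, rfl, (Option.some_injective _ ht).symm⟩
    · obtain ⟨g', hg, rfl⟩ := Option.map_eq_some_iff.1 ht
      rw [hg] at hs
      exact ⟨f, g', (Option.some_injective _ hs).symm, rfl⟩
  rcases hfg with ⟨e₁, e₂⟩ | ⟨e₁, e₂⟩
  · rw [e₁] at c₁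
    rw [e₂] at c₂
    obtain ⟨f', g', e⟩ := key _ _ c₁ c₂
    exact ⟨f', g', .inl e⟩
  · rw [e₁] at c₂
    rw [e₂] at c₁
    obtain ⟨f', g', e⟩ := key _ _ c₂ c₁
    exact ⟨f', g', .inr e⟩

/-- An operator carries a whiskered branching to a whiskered branching of the same shape. -/
theorem LocalBranching.exists_le_of_act (h : X.IsEquivariant D) (hR : IsNormal D R) {k : Kash I}
    {a b c : X.LocalBranching} (hc : b.act h k = some c) (hab : a.Le b) :
    ∃ a' : X.LocalBranching, a'.Le c ∧ a'.source.length = a.source.length := by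
  obtain ⟨c₁, c₂⟩ := (act_eq_some_iff h).1 hc
  obtain ⟨u, v, e₁, e₂⟩ := hab
  rw [e₁] at c₁
  rw [e₂] at c₂
  -- Both steps of `a` have the same source, so one case applies to both: either a context changes,
  -- identically for the two steps, or `a` itself is moved.
  rcases op_whisker_cases h hR k u a.source v with H | H | H <;>
    rw [H _ rfl] at c₁ <;> rw [H _ a.source_eq.symm] at c₂ <;>
    obtain ⟨x, hx, ex⟩ := Option.map_eq_some_iff.1 c₁ <;>
    obtain ⟨y, hy, ey⟩ := Option.map_eq_some_iff.1 c₂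
  · obtain rfl : x = y := Option.some_injective _ (hx.symm.trans hy)
    exact ⟨a, ⟨x, v, ex.symm, ey.symm⟩, rfl⟩
  · have h1 : op (D := D) k a.fst.source = some x.source := by rw [Polygraph.op_source h, hx]; rfl
    have h2 : op (D := D) k a.snd.source = some y.source := by rw [Polygraph.op_source h, hy]; rfl
    rw [← a.source_eq, h1] at h2
    exact ⟨⟨x, y, Option.some_injective _ h2⟩, ⟨u, v, ex.symm, ey.symm⟩, length_op h1⟩
  · obtain rfl : x = y := Option.some_injective _ (hx.symm.trans hy)
    exact ⟨a, ⟨u, x, ex.symm, ey.symm⟩, rfl⟩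

theorem Step.whisker_nil (s : X.Step) : s.whisker [] [] = s := by
  simp [whisker]

theorem LocalBranching.Le.length_le {a b : X.LocalBranching} (hab : a.Le b) :
    a.source.length ≤ b.source.length := by
  obtain ⟨u, v, e, -⟩ := hab
  rw [source, source, e, Step.source_whisker]
  simp
  omega

/-- The lengths force both contexts to be empty. -/
theorem LocalBranching.Le.symm_of_length_le {a b : X.LocalBranching} (hab : a.Le b)
    (hl : b.source.length ≤ a.source.length) : b.Le a := by
  obtain ⟨u, v, e₁, e₂⟩ := hab
  rw [source, source, e₁, Step.source_whisker] at hl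
  simp only [List.length_append] at hl
  obtain rfl : u = [] := List.length_eq_zero_iff.1 (by omega)
  obtain rfl : v = [] := List.length_eq_zero_iff.1 (by omega)
  rw [Step.whisker_nil] at e₁ e₂
  exact ⟨[], [], by rw [Step.whisker_nil, e₁], by rw [Step.whisker_nil, e₂]⟩

/-- Each condition is checked on `b` by going back along `k.inv`. Operators preserve lengths, which
turns minimality into a comparison of source lengths. -/
theorem LocalBranching.isCritical_of_act (h : X.IsEquivariant D) (hR : IsNormal D R) {k : Kash I}
    {b c : X.LocalBranching} (hc : b.act h k = some c) (hb : b.IsCritical) : c.IsCritical := by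
  have hi := act_inv h hR hc
  obtain ⟨c₁, c₂⟩ := (act_eq_some_iff h).1 hc
  refine ⟨fun e => hb.1 ?_, fun e => hb.2.1 (isPeiffer_of_act h hR hi e), fun a hac => ?_⟩
  · have e' : c.fst = c.snd := e
    rw [e'] at c₁
    exact (Step.opInvertible h hR).eq_of_op c₁ c₂
  -- Moving `a ⊑ c` back gives `a' ⊑ b` with `a'` as long as `a`; minimality of `b` bounds the
  -- length of `b`, which is that of `c`, by that of `a`.
  · obtain ⟨a', ha, hl⟩ := exists_le_of_act h hR hi hac
    have h1 := (hb.2.2 a' ha).length_le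
    have h2 := LocalBranching.op_source h k b
    rw [hc] at h2
    exact hac.symm_of_length_le (by rw [length_op h2]; omega)

/-! ### Operators on 2-spheres -/

theorem Sphere.act_inv (h : X.IsEquivariant D) (hR : IsNormal D R) {k : Kash I}
    {γ δ : X.Sphere} (hδ : γ.act h k = some δ) : δ.act h k.inv = some γ := by
  rw [act_eq_some_iff] at hδ ⊢
  exact ⟨Cell.act_inv h hR hδ.1, Cell.act_inv h hR hδ.2⟩

theorem Sphere.op_src (h : X.IsEquivariant D) (k : Kash I) (γ : X.Sphere) :
    op (D := D) k γ.fst.src = (γ.act h k).map fun δ => δ.fst.src := by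
  rcases hc : γ.act h k with - | δ
  · by_contra hne
    obtain ⟨w, hw⟩ := Option.ne_none_iff_exists'.1 hne
    have h1 := hw
    have h2 : op (D := D) k γ.snd.src = some w := γ.src_eq ▸ hw
    -- The two images are parallel because the operator acts on one common target.
    have t1 : op (D := D) k γ.fst.tgt = op (D := D) k γ.snd.tgt := by rw [γ.tgt_eq]
    rw [Cell.op_src h] at h1 h2
    obtain ⟨f, hf, ef⟩ := Option.map_eq_some_iff.1 h1
    obtain ⟨g, hg, eg⟩ := Option.map_eq_some_iff.1 h2
    rw [Cell.act_tgt h hf, Cell.act_tgt h hg] at t1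
    have := (act_eq_some_iff (δ := ⟨f, g, ef.trans eg.symm, Option.some_injective _ t1⟩) h).2
      ⟨hf, hg⟩
    rw [hc] at this
    cases this
  · exact Cell.act_src h ((act_eq_some_iff h).1 hc).1

theorem NormalizationStrategy.confluence_src {r : X.Section} (σ : NormalizationStrategy r)
    (b : X.LocalBranching) : (σ.confluence b).fst.src = b.source :=
  Cell.src_comp (Cell.ofStep b.fst) (σ.toFun b.fst.target)

end Polygraph

/-! ### The crystal of critical branchings -/

namespace CrystalPolygraph

open Polygraph

variable {I : Type*} {D : CartanDatum I} {A R : Type*} [CrystalData D A] [CrystalData D R]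
  (X : CrystalPolygraph D A R)

theorem branching_opInvertible : OpInvertible D X.LocalBranching :=
  fun _ _ _ => LocalBranching.act_inv X.isEquivariant X.rule_isCrystal.toIsNormal

theorem branching_source_isHom : IsHom D (LocalBranching.source (X := X.toPolygraph)) :=
  ⟨fun _ => rfl, fun _ _ => rfl, fun _ _ => rfl, LocalBranching.op_source X.isEquivariant⟩

theorem branching_applyOps_components {L : List (Kash I)} {b c : X.LocalBranching}
    (hc : applyOps D L b = some c) :
    applyOps D L b.fst = some c.fst ∧ applyOps D L b.snd = some c.snd := by
  induction L generalizing c with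
  | nil => exact (Option.some_injective _ hc) ▸ ⟨rfl, rfl⟩
  | cons k L ih =>
    obtain ⟨d, hd, hk⟩ := Option.bind_eq_some_iff.1 hc
    obtain ⟨h1, h2⟩ := (LocalBranching.act_eq_some_iff X.isEquivariant).1 hk
    rw [applyOps, applyOps, (ih hd).1, (ih hd).2]
    exact ⟨h1, h2⟩

theorem branching_source_injOnComponents :
    InjOnComponents D (LocalBranching.source (X := X.toPolygraph)) := by
  rintro b c ⟨L, hL⟩ e
  obtain ⟨h1, h2⟩ := X.branching_applyOps_components hL
  have hinj := Step.source_injOnComponents X.isEquivariant X.rule_isCrystal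
  exact LocalBranching.ext (hinj _ _ ⟨L, h1⟩ e)
    (hinj _ _ ⟨L, h2⟩ (b.source_eq.symm.trans (e.trans c.source_eq)))

theorem crit_val_isHom : IsHom D (Subtype.val : X.Crit → X.LocalBranching) :=
  restrict_isHom fun _ _ _ hb hc =>
    LocalBranching.isCritical_of_act X.isEquivariant X.rule_isCrystal.toIsNormal hc hb

theorem crit_opInvertible : OpInvertible D X.Crit :=
  X.branching_opInvertible.of_hom X.crit_val_isHom Subtype.val_injective

theorem crit_source_isHom : IsHom D (fun b : X.Crit => b.1.source) :=
  X.branching_source_isHom.comp X.crit_val_isHom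

theorem crit_source_injOnComponents : InjOnComponents D (fun b : X.Crit => b.1.source) :=
  fun _ _ hbc e =>
    Subtype.ext (X.branching_source_injOnComponents _ _ (X.crit_val_isHom.connected hbc) e)

theorem crit_isSubcrystal : IsSubcrystal D X.Crit :=
  ⟨X.gen_isCrystal.word.of_hom X.crit_source_isHom X.crit_opInvertible, X.crit_val_isHom⟩

theorem sphere_opInvertible : OpInvertible D X.Sphere :=
  fun _ _ _ => Sphere.act_inv X.isEquivariant X.rule_isCrystal.toIsNormal

theorem sphere_src_isHom : IsHom D (fun γ : X.Sphere => γ.fst.src) :=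
  ⟨fun _ => rfl, fun _ _ => rfl, fun _ _ => rfl, Sphere.op_src X.isEquivariant⟩

/-! ### The crystal of generating confluences -/

variable {X} {r : X.Section} {σ : NormalizationStrategy r} (hσ : X.IsCrystalStrategy σ)

include hσ

/-- The operator commutes with `⋆₁`, with the target map and with `σ`. -/
theorem IsCrystalStrategy.act_ofStep_comp {k : Kash I} {s s' : X.Step}
    (hs : op (D := D) k s = some s') :
    Cell.act X.isEquivariant k ((Cell.ofStep s).comp (σ.toFun s.target)) =
      some ((Cell.ofStep s').comp (σ.toFun s'.target)) := by
  refine Cell.act_comp X.isEquivariant (σ.src_toFun s.target).symm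
    (Cell.act_ofStep X.isEquivariant hs) (hσ k _ _ ?_)
  rw [op_target X.isEquivariant, hs]
  rfl

/-- The map `b ↦ γ_b` is a morphism of crystals from local branchings to 2-spheres. -/
theorem IsCrystalStrategy.confluence_isHom : IsHom D σ.confluence := by
  have hsrc := σ.confluence_src
  refine ⟨fun b => congrArg (wt (D := D)) (hsrc b), fun i b => congrArg (eps D i) (hsrc b),
    fun i b => congrArg (phi D i) (hsrc b), fun k b => ?_⟩
  rcases hc : op (D := D) k b with - | c
  -- Vanishing on `b` and on `γ_b` are both equivalent to vanishing on their common source word.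
  · have h1 := X.branching_source_isHom.op_eq k b
    have h2 := X.sphere_src_isHom.op_eq k (σ.confluence b)
    simp only [hsrc] at h2
    rw [h1, hc] at h2
    exact Option.map_eq_none_iff.1 h2.symm
  · obtain ⟨c₁, c₂⟩ := (LocalBranching.act_eq_some_iff X.isEquivariant).1 hc
    exact (Sphere.act_eq_some_iff X.isEquivariant).2
      ⟨hσ.act_ofStep_comp c₁, hσ.act_ofStep_comp c₂⟩

theorem IsCrystalStrategy.val_isHom :
    IsHom D (Subtype.val : σ.generatingConfluences → X.Sphere) := by
  refine restrict_isHom ?_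
  rintro k _ δ ⟨b, hb, rfl⟩ hδ
  rw [hσ.confluence_isHom.op_eq] at hδ
  obtain ⟨c, hc, rfl⟩ := Option.map_eq_some_iff.1 hδ
  exact ⟨c, LocalBranching.isCritical_of_act X.isEquivariant X.rule_isCrystal.toIsNormal hc hb,
    rfl⟩

theorem IsCrystalStrategy.opInvertible : OpInvertible D σ.generatingConfluences :=
  X.sphere_opInvertible.of_hom hσ.val_isHom Subtype.val_injective

theorem IsCrystalStrategy.src_isHom :
    IsHom D (fun γ : σ.generatingConfluences => γ.1.fst.src) :=
  X.sphere_src_isHom.comp hσ.val_isHom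

/-- A path in `Ω` starting at `γ_b` lifts to a path of local branchings starting at `b`, where the
source map is already injective on components. -/
theorem IsCrystalStrategy.src_injOnComponents :
    InjOnComponents D (fun γ : σ.generatingConfluences => γ.1.fst.src) := by
  rintro ⟨_, b, hb, rfl⟩ ⟨δ, hδ⟩ hc e
  obtain ⟨c, hbc, rfl⟩ := hσ.confluence_isHom.exists_connected (hσ.val_isHom.connected hc)
  simp only [σ.confluence_src] at e
  exact Subtype.ext (congrArg σ.confluence (X.branching_source_injOnComponents b c hbc e))

theorem IsCrystalStrategy.generatingConfluences_isSubcrystal :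
    IsSubcrystal D σ.generatingConfluences :=
  ⟨X.gen_isCrystal.word.of_hom hσ.src_isHom hσ.opInvertible, hσ.val_isHom⟩

end CrystalPolygraph

end Crystal

theorem mainTheorem1 {I : Type*} [Finite I] (D : CartanDatum I)
    {A R : Type*} [CrystalData D A] [CrystalData D R] (X : Crystal.CrystalPolygraph D A R)
    (hX : X.IsConvergent)
    (r : X.Section) (hr : Crystal.IsHom D r.toFun)
    (σ : Crystal.Polygraph.NormalizationStrategy r) (hσ : X.IsCrystalStrategy σ) :
    -- `Ω` is a subcrystal of the 2-spheres of `X_2^⊤`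
    Crystal.IsSubcrystal D σ.generatingConfluences ∧
    -- the critical branchings form a crystal and `b ↦ γ_b` is a morphism of crystals
    Crystal.IsSubcrystal D X.Crit ∧
    Crystal.IsHom D (fun b : X.Crit => σ.confluence b.1) ∧
    -- the source map is an isomorphism from each connected component of `Ω` onto a connected
    -- component of the free crystal monoid
    (∀ γ : σ.generatingConfluences, Set.BijOn (fun δ => δ.1.fst.src)
      {δ | Crystal.Connected D γ δ} {w | Crystal.Connected D γ.1.fst.src w}) ∧
    -- every critical branching `b` is obtained by operators `f_i` from one of highest weight, `b₀`,
    -- and `γ_b` is obtained from `γ_{b₀}` by the same operators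
    (∀ b : X.Crit, ∃ b₀ : X.Crit, Crystal.IsHighestWeight D b₀ ∧
      ∃ L : List I, Crystal.applyOps D (L.map Kash.f) b₀ = some b ∧
        Crystal.applyOps D (L.map Kash.f) (σ.confluence b₀.1) = some (σ.confluence b.1)) ∧
    -- whichever Kashiwara operators lead from `b₀` to `b`, they lead from `γ_{b₀}` to `γ_b`
    (∀ b b₀ : X.Crit, Crystal.IsHighestWeight D b₀ → ∀ L : List (Kash I),
      Crystal.applyOps D L b₀ = some b →
        Crystal.applyOps D L (σ.confluence b₀.1) = some (σ.confluence b.1)) ∧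
    -- if the components of the free crystal monoid are highest weight crystals, then so are those
    -- of `Ω`, and the critical branching of highest weight in a component is unique
    (Crystal.IsCrystal D (List A) →
      Crystal.IsCrystal D σ.generatingConfluences ∧
      ∀ b : X.Crit, ∃! b₀ : X.Crit, Crystal.IsHighestWeight D b₀ ∧ Crystal.Connected D b b₀) := by
  have hγ := hσ.confluence_isHom.comp X.crit_val_isHom
  have key : ∀ (L : List (Kash I)) (b b₀ : X.Crit), Crystal.applyOps D L b₀ = some b →
      Crystal.applyOps D L (σ.confluence b₀.1) = some (σ.confluence b.1) := fun L b b₀ hL => by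
    rw [hγ.applyOps L b₀, hL]
    rfl
  refine ⟨hσ.generatingConfluences_isSubcrystal, X.crit_isSubcrystal, hγ,
    hσ.src_isHom.bijOn_component hσ.src_injOnComponents hσ.opInvertible, fun b => ?_,
    fun b b₀ _ L hL => key L b b₀ hL, fun hA => ⟨.of_hom hσ.src_isHom hσ.src_injOnComponents
      hσ.opInvertible hA, fun b => ?_⟩⟩
  -- The depth of letters, summed over the source word, is a height on critical branchings.
  · obtain ⟨n, hn⟩ := X.gen_isCrystal.exists_isHeight
    obtain ⟨b₀, hb₀, L, hL⟩ :=
      (hn.word.of_hom X.crit_source_isHom).exists_lowersTo X.crit_opInvertible b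
    exact ⟨b₀, hb₀, L, hL, key _ _ _ hL⟩
  -- Uniqueness is read off from the crystal structure pulled back to `X.Crit` along the source map.
  · have hC : Crystal.IsCrystal D X.Crit :=
      .of_hom X.crit_source_isHom X.crit_source_injOnComponents X.crit_opInvertible hA
    obtain ⟨b₀, hb₀, -, huniq, -⟩ := hC.component b
    exact ⟨b₀, ⟨(huniq b₀ hb₀).2 rfl, hb₀⟩, fun c hc => (huniq c hc.2).1 hc.1⟩
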